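/- Let $R$ be an excellent normal local domain with quotient field $K$, let $L$ and $M$ be finite separable extensions of $K$ contained in a common overfield, and let $\Omega=LM$ be their compositum. Let $A_s$ be the integral closure of $R$ in $\Omega$, let $A\subset\Omega$ be the localization of $A_s$ at a maximal ideal, and put $S=A\cap L$ and $T=A\cap M$. Then $S$ and $T$ are excellent normal local domains. The completions $\widehat R,\widehat S,\widehat T,\widehat A$ at the maximal ideals are domains and the natural maps $\widehat R\to\widehat A$, $\widehat S\to\widehat A$, $\widehat T\to\widehat A$ are injective, so the quotient fields $\widehat K,\widehat L,\widehat M$ of $\widehat R,\widehat S,\widehat T$ are subfields of the quotient field $\widehat\Omega$ of $\widehat A$. Write $m_A,m_S,m_T$ for the maximal ideals of $A,S,T$. 1. If $A/m_A$ is the compositum of $S/m_S$ and $T/m_T$, then $\widehat\Omega=\widehat L\widehat M$. 2. If $A/m_A$ is a separable extension of $S/m_S$, then $\widehat\Omega$ is an unramified extension of $\widehat L\widehat M$. Here "unramified" means the following: $\widehat\Omega/\widehat L\widehat M$ is a finite separable field extension, the integral closure $B$ of $\widehat R$ in $\widehat L\widehat M$ is a local ring with maximal ideal $m_B$, and for every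 prime ideal $Q$ above $m_B$ of the integral closure $C$ of $B$ in $\widehat\Omega$ one has $m_BC_Q=QC_Q$, and $C_Q/QC_Q$ is a finite separable extension of $B/m_B$. -/

import Mathlib

universe u

open IsLocalRing TensorProduct

namespace LocalTheory

/-! ### Excellent rings -/

/-- A (Noetherian) ring is catenary if, for all primes `p ⊆ q`, any two saturated chains of primes
from `p` to `q` have the same length.  (In a Noetherian ring chains of primes between `p` and `q`
have bounded length, so nothing has to be said about infinite chains.) -/
def IsCatenary (B : Type*) [CommRing B] : Prop :=
  ∀ c d : RelSeries {(p, q) : PrimeSpectrum B × PrimeSpectrum B | p ⋖ q},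
    c.head = d.head → c.last = d.last → c.length = d.length

/-- Every algebra of finite type is catenary. -/
def IsUniversallyCatenary (R : Type u) [CommRing R] : Prop :=
  ∀ (B : Type u) [CommRing B] [Algebra R B], Algebra.FiniteType R B → IsCatenary B

/-- A `k`-algebra `C` over a field `k` is geometrically regular if `k' ⊗ C` is a regular ring for
every finite field extension `k'` of `k`. -/
def IsGeometricallyRegular (k : Type u) [Field k] (C : Type*) [CommRing C] [Algebra k C] : Prop :=
  ∀ (k' : Type u) [Field k'] [Algebra k k'], FiniteDimensional k k' → IsRegularRing (k' ⊗[k] C)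

/-- The completion `Â` of a local ring `A` at its maximal ideal. -/
abbrev Completion (A : Type*) [CommRing A] [IsLocalRing A] : Type _ :=
  AdicCompletion (maximalIdeal A) A

/-- The formal fibres `κ(q) ⊗ Â` of the local ring `A` are geometrically regular. -/
def HasGeometricallyRegularFormalFibers (A : Type*) [CommRing A] [IsLocalRing A] : Prop :=
  ∀ (q : Ideal A) [q.IsPrime], IsGeometricallyRegular q.ResidueField (q.Fiber (Completion A))

/-- All local rings have geometrically regular formal fibres. -/
def IsGRing (R : Type*) [CommRing R] : Prop :=
  ∀ (p : Ideal R) [p.IsPrime], HasGeometricallyRegularFormalFibers (Localization.AtPrime p)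

/-- For every algebra of finite type the regular locus is open. -/
def IsJ2 (R : Type u) [CommRing R] : Prop :=
  ∀ (B : Type u) [CommRing B] [Algebra R B], Algebra.FiniteType R B →
    IsOpen {x : PrimeSpectrum B | IsRegularLocalRing (Localization.AtPrime x.asIdeal)}

/-- Excellent rings. -/
structure IsExcellentRing (R : Type u) [CommRing R] : Prop where
  isNoetherianRing : IsNoetherianRing R
  isUniversallyCatenary : IsUniversallyCatenary R
  isGRing : IsGRing R
  isJ2 : IsJ2 R

/-! ### Functoriality of the completion and of the quotient field -/

section Completion

variable {A B : Type*} [CommRing A] [CommRing B] [IsLocalRing A] [IsLocalRing B]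

theorem pow_le_comap (f : A →+* B) [IsLocalHom f] (n : ℕ) :
    maximalIdeal A ^ n ≤ (maximalIdeal B ^ n).comap f := by
  have h : maximalIdeal A ≤ (maximalIdeal B).comap f := ((local_hom_TFAE f).out 0 3).mp ‹_›
  exact (Ideal.pow_right_mono h n).trans (Ideal.le_comap_pow f n)

theorem completionMap_compatible (f : A →+* B) [IsLocalHom f] {m n : ℕ} (hle : m ≤ n) :
    (Ideal.Quotient.factorPow (maximalIdeal B) hle).comp
      ((Ideal.quotientMap (maximalIdeal B ^ n) f (pow_le_comap f n)).comp
        (AdicCompletion.evalₐ (maximalIdeal A) n : Completion A →+* A ⧸ maximalIdeal A ^ n)) =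
      (Ideal.quotientMap (maximalIdeal B ^ m) f (pow_le_comap f m)).comp
        (AdicCompletion.evalₐ (maximalIdeal A) m : Completion A →+* A ⧸ maximalIdeal A ^ m) := by
  ext x
  obtain ⟨a, rfl⟩ := AdicCompletion.mk_surjective _ _ x
  simp only [RingHom.coe_comp, RingHom.coe_coe, Function.comp_apply, AdicCompletion.evalₐ_mk,
    Ideal.quotientMap_mk]
  have h := congrArg (Ideal.quotientMap (maximalIdeal B ^ m) f (pow_le_comap f m))
    (AdicCompletion.Ideal.mk_eq_mk (maximalIdeal A) hle a)
  rw [Ideal.quotientMap_mk, Ideal.quotientMap_mk] at h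
  exact h

/-- The ring homomorphism `Â → B̂` induced by a local homomorphism `A → B`; modulo the `n`-th powers
of the maximal ideals it is the map `A ⧸ m_A ^ n → B ⧸ m_B ^ n` induced by `f`. -/
noncomputable def completionMap (f : A →+* B) [IsLocalHom f] : Completion A →+* Completion B :=
  AdicCompletion.liftRingHom (maximalIdeal B)
    (fun n => (Ideal.quotientMap (maximalIdeal B ^ n) f (pow_le_comap f n)).comp
      (AdicCompletion.evalₐ (maximalIdeal A) n : Completion A →+* A ⧸ maximalIdeal A ^ n))
    (completionMap_compatible f)

/-- `Â → B̂` extends `A → B`. -/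
theorem completionMap_algebraMap (f : A →+* B) [IsLocalHom f] (a : A) :
    completionMap f (algebraMap A (Completion A) a) = algebraMap B (Completion B) (f a) := by
  apply AdicCompletion.ext_evalₐ
  intro n
  refine (AdicCompletion.evalₐ_liftRingHom (maximalIdeal B) _
    (completionMap_compatible f) n _).trans ?_
  simp [AdicCompletion.algebraMap_apply]

end Completion

/-- For domains `D` and `D'` and an injective homomorphism `g : D → D'`, the quotient field of `D`
as a subfield of the quotient field of `D'`. -/
noncomputable def quotientSubfield {D D' : Type*} [CommRing D] [CommRing D'] [IsDomain D]
    [IsDomain D'] {g : D →+* D'} (hg : Function.Injective g) : Subfield (FractionRing D') :=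
  (IsFractionRing.map hg : FractionRing D →+* FractionRing D').fieldRange

/-! ### Unramified extensions -/

/-- The field extension given by `f : k → l` is separable (algebraic). -/
def IsSeparableHom {k l : Type*} [Field k] [Field l] (f : k →+* l) : Prop :=
  letI := f.toAlgebra
  Algebra.IsSeparable k l

/-- For a `B`-algebra `C`, a prime `Q` of `C` and `P = Q ∩ B`: `P C_Q = Q C_Q`, and the residue
field extension `κ(Q) / κ(P)` is finite and separable. -/
structure IsUnramifiedAtPrime (B : Type*) {C : Type*} [CommRing B] [CommRing C] [Algebra B C]
    (Q : Ideal C) [Q.IsPrime] : Prop where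
  map_eq : (Q.under B).map (algebraMap B (Localization.AtPrime Q)) =
    maximalIdeal (Localization.AtPrime Q)
  finite : (Ideal.ResidueField.map (Q.under B) Q (algebraMap B C) rfl).Finite
  separable : IsSeparableHom (Ideal.ResidueField.map (Q.under B) Q (algebraMap B C) rfl)

/-- The integral closure of a subring `O` of the field `F` in the subfield `E` of `F`. -/
def integralClosureIn {F : Type*} [Field F] (O : Subring F) (E : Subfield F) : Subring F :=
  (integralClosure O F).toSubring ⊓ E.toSubring

/-- Let `O` be a complete local domain, contained in a field `F`, and let `E` be a subfield of `F`.
The extension `F / E` is unramified (with respect to `O`) if it is finite separable, the integral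
closure `B` of `O` in `E` is a local ring, and every prime of the integral closure of `B` in `F`
above the maximal ideal of `B` (that is, every maximal ideal) is unramified over `B`. -/
structure IsUnramifiedExtension {F : Type*} [Field F] (O : Subring F) (E : Subfield F) : Prop where
  finite : FiniteDimensional E F
  separable : Algebra.IsSeparable E F
  isLocalRing : IsLocalRing (integralClosureIn O E)
  unramified : ∀ (Q : Ideal (integralClosure (integralClosureIn O E) F)) [Q.IsMaximal],
    IsUnramifiedAtPrime (integralClosureIn O E) Q

/-! ### The local rings `A`, `A ∩ L` and `A ∩ M` -/

theorem mem_ofPrime {Ω : Type*} [Field Ω] (C : Subring Ω) (n : Ideal C) [n.IsPrime] {x : Ω} :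
    x ∈ (LocalSubring.ofPrime C n).toSubring ↔ ∃ a s : C, s ∉ n ∧ x = a / s := by
  have h0 : ∀ {s : C}, s ∉ n → (s : Ω) ≠ 0 := fun {s} hs h =>
    hs ((Subtype.ext h : s = 0) ▸ n.zero_mem)
  have hu : ∀ y : n.primeCompl, IsUnit (C.subtype y) := fun y => (h0 y.2).isUnit
  constructor
  · rintro ⟨y, rfl⟩
    obtain ⟨a, s, rfl⟩ := IsLocalization.exists_mk'_eq n.primeCompl y
    refine ⟨a, s.1, s.2, ?_⟩
    rw [eq_div_iff (h0 s.2), mul_comm]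
    exact ((IsLocalization.lift_mk'_spec (g := C.subtype) (hg := hu) a _ s).mp rfl).symm
  · rintro ⟨a, s, hs, rfl⟩
    refine ⟨IsLocalization.mk' (M := n.primeCompl) _ a ⟨s, hs⟩, ?_⟩
    refine (IsLocalization.lift_mk'_spec (g := C.subtype) (hg := hu) a _ ⟨s, hs⟩).mpr ?_
    exact (mul_div_cancel₀ (a : Ω) (h0 hs)).symm

section Localization

variable (R : Type*) {Ω : Type*} [CommRing R] [Field Ω] [Algebra R Ω]

/-- The localization, as a subring of `Ω`, of the integral closure of `R` in `Ω` at the prime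
ideal `n`. -/
noncomputable def localRingAt (n : Ideal (integralClosure R Ω)) [n.IsPrime] : LocalSubring Ω :=
  @LocalSubring.ofPrime Ω _ (integralClosure R Ω).toSubring n ‹_›

variable {R} (n : Ideal (integralClosure R Ω)) [n.IsPrime]

theorem le_localRingAt (x : integralClosure R Ω) : (x : Ω) ∈ (localRingAt R n).toSubring :=
  @LocalSubring.le_ofPrime Ω _ (integralClosure R Ω).toSubring n ‹_› x x.2

theorem mem_localRingAt {x : Ω} : x ∈ (localRingAt R n).toSubring ↔
    ∃ a s : integralClosure R Ω, s ∉ n ∧ x = a / s :=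
  @mem_ofPrime Ω _ (integralClosure R Ω).toSubring n ‹_› x

/-- The canonical homomorphism `R → A`. -/
def toLocalRingAt : R →+* (localRingAt R n).toSubring where
  toFun r := ⟨algebraMap R Ω r, le_localRingAt n (algebraMap R (integralClosure R Ω) r)⟩
  map_one' := Subtype.ext (map_one _)
  map_mul' _ _ := Subtype.ext (map_mul _ _ _)
  map_zero' := Subtype.ext (map_zero _)
  map_add' _ _ := Subtype.ext (map_add _ _ _)

instance [IsLocalRing R] [n.IsMaximal] : IsLocalHom (toLocalRingAt n) where
  map_nonunit r hr := by
    obtain ⟨b, hb⟩ := hr.exists_right_inv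
    have hb' : algebraMap R Ω r * b = 1 := congrArg Subtype.val hb
    obtain ⟨a, s, hs, hbas⟩ := (mem_localRingAt n).mp b.2
    have hs0 : (s : Ω) ≠ 0 := fun h => hs ((Subtype.ext h : s = 0) ▸ n.zero_mem)
    have has : s = algebraMap R (integralClosure R Ω) r * a := by
      apply Subtype.ext
      change (s : Ω) = algebraMap R Ω r * a
      rw [hbas, ← mul_div_assoc, div_eq_one_iff_eq hs0] at hb'
      exact hb'.symm
    by_contra hu
    have hmax : (n.comap (algebraMap R (integralClosure R Ω))).IsMaximal :=
      Ideal.isMaximal_comap_of_isIntegral_of_isMaximal n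
    have hr' : r ∈ n.comap (algebraMap R (integralClosure R Ω)) := by
      rw [eq_maximalIdeal hmax]
      exact hu
    exact hs (has ▸ n.mul_mem_right a hr')

end Localization

section Intersection

variable {Ω : Type*} [Field Ω] (A : LocalSubring Ω) (L : Subfield Ω)

theorem inter_le : A.toSubring ⊓ L.toSubring ≤ A.toSubring := inf_le_left

instance isLocalHom_inclusion : IsLocalHom (Subring.inclusion (inter_le A L)) where
  map_nonunit a ha := by
    obtain ⟨b, hb⟩ := ha.exists_right_inv
    have h : (a : Ω) * b = 1 := congrArg Subtype.val hb
    have hbL : (b : Ω) ∈ L := by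
      rw [eq_inv_of_mul_eq_one_right h]
      exact L.inv_mem a.2.2
    exact IsUnit.of_mul_eq_one ⟨b, b.2, hbL⟩ (Subtype.ext h)

/-- The intersection `A ∩ L` of a local subring `A` and a subfield `L` of the field `Ω`. -/
def interSubfield : LocalSubring Ω where
  toSubring := A.toSubring ⊓ L.toSubring
  isLocalRing := RingHom.domain_isLocalRing (Subring.inclusion (inter_le A L))

/-- The inclusion `A ∩ L → A`. -/
def inclusion : (interSubfield A L).toSubring →+* A.toSubring :=
  Subring.inclusion (inter_le A L)

instance : IsLocalHom (inclusion A L) := isLocalHom_inclusion A L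

end Intersection

end LocalTheory

open LocalTheory

/-!
The point of the proof is that `Â` is a direct factor of `A_s ⊗ R̂`, where `A_s` is the integral
closure of `R` in `Ω`: as `A_s` is a finite `R`-algebra, `A_s ⊗ R̂` is complete and semilocal, and
`A` is the local ring of `A_s` at a maximal ideal (`tensorCompletionMap_surjective_and_ker`). Hence
`Â` is generated by the images of `R̂` and `A_s`, and its quotient field by those of `R̂` and `Ω`.
The subfield generated by the quotient fields of `Ŝ` and `T̂` contains `R̂`, `L` and `M`, hence also
`Ω = L M`, so it is the whole quotient field of `Â` (`subfield_eq_top_of_mem`,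
`mem_subfield_of_sup_eq_top`). This gives the first conclusion, and reduces the second one to the
trivial extension, where only the locality of the integral closure of `R̂` remains to be shown: a
domain integral over a complete local ring is local, because idempotents lift
(`isLocalRing_of_isIntegral_completion`).

That the completions are domains, and that the maps between them are injective, is shown as follows.

* `S = A ∩ L` is the local ring at `n ∩ L` of the integral closure of `R` in `L`
  (`isLocalization_interSubfield`). In a Galois closure this follows from the transitivity of the
  Galois group on the primes over a given prime: for `x ∈ A ∩ L` the ideal of denominators of `x` is
  stable under the group, and it is not contained in the given prime over `n`, hence in no prime
  over `n ∩ L`.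
* A localization of a finite algebra over an excellent ring is excellent
  (`IsExcellentRing.of_isLocalization`). For the formal fibres this rests once more on the
  description of the completion as a direct factor of a tensor product.
* The completion of a normal local ring with geometrically regular formal fibres is a domain
  (`isDomain_completion`): by flatness and by reducedness of the fibres, it is integrally closed in
  its generic fibre, so that this fibre, a regular ring, has no idempotents but `0` and `1`, and a
  regular ring with this property is a domain.
* `A_s ⊗ R̂ ⊆ Ω ⊗ R̂` is torsion-free over the domain `R̂`, so `R̂` embeds into its direct factor
  `Â`. As `Ŝ` is a domain that is integral over `R̂`, the map from `Ŝ` to `Â` is injective too.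
-/

/-! ### Regular rings -/

/-- If the maximal ideal of `R` is generated by at most `n ≤ dim R` elements, `R` is a domain. -/
theorem IsLocalRing.isDomain_of_card_le_ringKrullDim (n : ℕ) : ∀ (R : Type u) [CommRing R]
    [IsLocalRing R] [IsNoetherianRing R] (s : Finset R), maximalIdeal R = Ideal.span (s : Set R) →
    s.card ≤ n → (n : WithBot ℕ∞) ≤ ringKrullDim R → IsDomain R := by
  classical
  induction n with
  | zero =>
    intro R _ _ _ s hs hn _
    obtain rfl : s = ∅ := by simpa using hn
    have hbot : maximalIdeal R = ⊥ := by simpa using hs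
    exact (isField_iff_maximalIdeal_eq.mpr hbot).isDomain
  | succ n ih =>
    intro R _ _ _ s hs hn hdim
    have hpos : ¬ ringKrullDim R ≤ 0 := fun h => by
      have := hdim.trans h
      norm_cast at this
    -- by prime avoidance some `x ∈ m` lies neither in `m ^ 2` nor in a minimal prime
    obtain ⟨x, hxm, hx2, hxmin⟩ : ∃ x ∈ maximalIdeal R, x ∉ maximalIdeal R ^ 2 ∧
        ∀ p ∈ minimalPrimes R, x ∉ p := by
      by_contra! hcon
      have hfin := minimalPrimes.finite_of_isNoetherianRing R
      have hsub : ((maximalIdeal R : Ideal R) : Set R) ⊆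
          ⋃ i ∈ (↑(insert (maximalIdeal R ^ 2) hfin.toFinset) : Set (Ideal R)),
            (id i : Ideal R) := by
        intro x hx
        simp only [Finset.coe_insert, Set.Finite.coe_toFinset, Set.mem_insert_iff,
          Set.iUnion_iUnion_eq_or_left, Set.mem_union, Set.mem_iUnion]
        by_cases h2 : x ∈ maximalIdeal R ^ 2
        · exact Or.inl h2
        · obtain ⟨p, hp, hxp⟩ := hcon x hx h2
          exact Or.inr ⟨p, hp, hxp⟩
      rw [Ideal.subset_union_prime (maximalIdeal R ^ 2) (maximalIdeal R ^ 2)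
        (fun i hi h _ => by
          have : i ∈ minimalPrimes R := by simpa [h] using hi
          exact this.1.1)] at hsub
      obtain ⟨p, hp, hle⟩ := hsub
      simp only [Finset.mem_insert, Set.Finite.mem_toFinset] at hp
      rcases hp with rfl | hp
      · have hbot : maximalIdeal R = ⊥ := by
          refine Submodule.eq_bot_of_le_smul_of_le_jacobson_bot (maximalIdeal R) _
            (IsNoetherian.noetherian _) ?_ (maximalIdeal_le_jacobson _)
          simpa [pow_two] using hle
        apply hpos
        rw [ringKrullDim_eq_zero_of_isField (isField_iff_maximalIdeal_eq.mpr hbot)]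
      · have hpm : p = maximalIdeal R :=
          le_antisymm (le_maximalIdeal hp.1.1.ne_top) hle
        apply hpos
        rw [← maximalIdeal_height_eq_ringKrullDim, ← hpm]
        have := hp.1.1
        have : p.height = 0 := Ideal.height_eq_zero_iff.mpr hp
        rw [this]; rfl
    -- `x` can be exchanged for one of the generators
    obtain ⟨y, hys, hspan⟩ : ∃ y ∈ s, maximalIdeal R ≤ Ideal.span (insert x ↑(s.erase y)) := by
      have hx : x ∈ Ideal.span (s : Set R) := hs ▸ hxm
      obtain ⟨a, ha⟩ := Submodule.mem_span_finset'.mp hx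
      have : ∃ y : s, a y ∉ maximalIdeal R := by
        by_contra! h
        apply hx2
        rw [← ha, pow_two]
        refine Ideal.sum_mem _ fun y _ => Ideal.mul_mem_mul (h y) ?_
        rw [hs]; exact Ideal.subset_span y.2
      obtain ⟨y, hy⟩ := this
      refine ⟨y, y.2, ?_⟩
      rw [hs, Ideal.span_le]
      intro z hz
      by_cases hzy : z = y
      · subst hzy
        have hu : IsUnit (a y) := notMem_maximalIdeal.mp hy
        rw [SetLike.mem_coe, ← Ideal.unit_mul_mem_iff_mem _ hu]
        have h1 : a y * (y : R) = x - ∑ z ∈ Finset.univ.erase y, a z • (z : R) := by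
          rw [eq_sub_iff_add_eq, ← smul_eq_mul,
            Finset.add_sum_erase _ (fun z : s => a z • (z : R)) (Finset.mem_univ y), ha]
        rw [h1]
        refine Ideal.sub_mem _ (Ideal.subset_span (Set.mem_insert _ _)) ?_
        refine Ideal.sum_mem _ fun z hz => Ideal.mul_mem_left _ _ (Ideal.subset_span ?_)
        refine Set.mem_insert_of_mem _ ?_
        have : z ≠ y := Finset.ne_of_mem_erase hz
        exact Finset.mem_coe.mpr (Finset.mem_erase.mpr ⟨fun h => this (Subtype.ext h), z.2⟩)
      · exact Ideal.subset_span (Set.mem_insert_of_mem _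
          (Finset.mem_coe.mpr (Finset.mem_erase.mpr ⟨hzy, hz⟩)))
    -- induction applied to `R ⧸ (x)`
    have hne : Ideal.span {x} ≠ ⊤ := fun h => (mem_maximalIdeal x).mp hxm
      (Ideal.span_singleton_eq_top.mp h)
    have : Nontrivial (R ⧸ Ideal.span {x}) := Ideal.Quotient.nontrivial_iff.mpr hne
    have : IsLocalRing (R ⧸ Ideal.span {x}) :=
      IsLocalRing.of_surjective' _ Ideal.Quotient.mk_surjective
    have hmap : maximalIdeal (R ⧸ Ideal.span {x}) =
        (maximalIdeal R).map (Ideal.Quotient.mk (Ideal.span {x})) := by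
      refine (eq_maximalIdeal ?_).symm
      exact Ideal.IsMaximal.map_of_surjective_of_ker_le Ideal.Quotient.mk_surjective
        (by rw [Ideal.mk_ker]; exact le_maximalIdeal hne)
    have hdom : IsDomain (R ⧸ Ideal.span {x}) := by
      refine ih _ ((s.erase y).image (Ideal.Quotient.mk (Ideal.span {x}))) ?_ ?_ ?_
      · rw [hmap, Finset.coe_image, ← Ideal.map_span]
        apply le_antisymm
        · refine (Ideal.map_mono hspan).trans ?_
          rw [Ideal.map_span, Ideal.span_le]
          rintro _ ⟨z, hz, rfl⟩
          rcases hz with rfl | hz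
          · have : Ideal.Quotient.mk (Ideal.span {z}) z = 0 :=
              Ideal.Quotient.eq_zero_iff_mem.mpr (Ideal.mem_span_singleton_self z)
            rw [this]; exact Ideal.zero_mem _
          · exact Ideal.mem_map_of_mem _ (Ideal.subset_span hz)
        · refine Ideal.map_mono ?_
          rw [hs]
          exact Ideal.span_mono (Finset.coe_subset.mpr (Finset.erase_subset _ _))
      · refine Finset.card_image_le.trans ?_
        rw [Finset.card_erase_of_mem hys]; omega
      · have h := ringKrullDim_le_ringKrullDim_quotient_add_card (R := R) {x}
          (by simpa [ringJacobson_eq_maximalIdeal] using hxm)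
        have h2 := hdim.trans h
        rw [Finset.coe_singleton, Finset.card_singleton] at h2
        generalize ringKrullDim (R ⧸ Ideal.span {x}) = d at h2 ⊢
        induction d with
        | bot => simp at h2
        | coe d =>
          norm_cast at h2 ⊢
          exact (ENat.add_le_add_iff_right (by simp)).mp h2
    have hprime : (Ideal.span {x}).IsPrime := (Ideal.Quotient.isDomain_iff_prime _).mp hdom
    obtain ⟨p, hp, hpx⟩ := Ideal.exists_minimalPrimes_le (bot_le : ⊥ ≤ Ideal.span {x})
    have hpbot : p = ⊥ := by
      refine Submodule.eq_bot_of_le_smul_of_le_jacobson_bot (maximalIdeal R) _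
        (IsNoetherian.noetherian _) ?_ (maximalIdeal_le_jacobson _)
      intro z hz
      obtain ⟨w, rfl⟩ := Ideal.mem_span_singleton.mp (hpx hz)
      have hw : w ∈ p := (hp.1.1.mem_or_mem hz).resolve_left (hxmin p hp)
      exact Submodule.smul_mem_smul hxm hw
    have : (⊥ : Ideal R).IsPrime := hpbot ▸ hp.1.1
    exact IsDomain.of_bot_isPrime R

theorem IsRegularLocalRing.isDomain (R : Type u) [CommRing R] [IsRegularLocalRing R] :
    IsDomain R := by
  obtain ⟨s, hs, hspan⟩ := Submodule.FG.exists_span_finset_card_eq_spanFinrank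
    (IsNoetherian.noetherian (maximalIdeal R))
  refine isDomain_of_card_le_ringKrullDim s.card R s hspan.symm le_rfl ?_
  rw [hs, IsRegularLocalRing.spanFinrank_maximalIdeal]

section

variable {P Q : Type*} [CommRing P] [CommRing Q]

theorem IsRegularRing.isReduced (P : Type u) [CommRing P] [IsRegularRing P] : IsReduced P := by
  refine ⟨fun x hx => ?_⟩
  refine eq_zero_of_localization x fun J hJ => ?_
  have := IsRegularLocalRing.isDomain (Localization.AtPrime J)
  exact (hx.map (algebraMap P (Localization.AtPrime J))).eq_zero

theorem IsRegularRing.of_isLocalization [IsRegularRing P] [Algebra P Q] (N : Submonoid P)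
    [IsLocalization N Q] : IsRegularRing Q := by
  have := IsLocalization.isNoetherianRing N Q inferInstance
  refine isRegularRing_iff.mpr fun p hp => ?_
  have := IsLocalization.isLocalization_isLocalization_atPrime_isLocalization N
    (Localization.AtPrime p) p
  exact IsRegularLocalRing.of_ringEquiv (IsLocalization.algEquiv
    (p.comap (algebraMap P Q)).primeCompl (Localization.AtPrime (p.comap (algebraMap P Q)))
    (Localization.AtPrime p)).toRingEquiv

/-- A direct factor of a regular ring is regular, being the localization away from an idempotent. -/
theorem IsRegularRing.of_surjective_of_ker_eq_span [IsRegularRing P] {f : P →+* Q}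
    (hf : Function.Surjective f) {e : P} (he : IsIdempotentElem e)
    (hker : RingHom.ker f = Ideal.span {e}) : IsRegularRing Q := by
  let := f.toAlgebra
  have : IsLocalization.Away (1 - e) Q :=
    IsLocalization.away_of_isIdempotentElem he.one_sub (by rw [sub_sub_cancel]; exact hker) hf
  exact IsRegularRing.of_isLocalization (.powers (1 - e))

/-- A regular ring without nontrivial idempotents has no zero divisors: the annihilator of an
element is locally zero or the unit ideal, so it is idempotent, hence generated by an
idempotent. -/
theorem IsRegularRing.noZeroDivisors {P : Type u} [CommRing P] [IsRegularRing P]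
    (h : ∀ e : P, IsIdempotentElem e → e = 0 ∨ e = 1) : NoZeroDivisors P := by
  refine ⟨fun {a b} hab => ?_⟩
  let I : Ideal P := Ideal.span {a} |>.annihilator
  have hmem : ∀ {z}, z ∈ I ↔ z * a = 0 := fun {z} => by
    simp [I]
  have hI : IsIdempotentElem I := by
    refine le_antisymm Ideal.mul_le_left fun z hz => ?_
    refine Submodule.mem_of_localization_maximal (fun J _ => Localization.AtPrime J)
      (fun J _ => Algebra.linearMap P (Localization.AtPrime J)) _ _ fun J hJ => ?_
    have := IsRegularLocalRing.isDomain (Localization.AtPrime J)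
    by_cases hIJ : I ≤ J
    · -- locally `a ≠ 0`, so the annihilator vanishes
      have hza : algebraMap P (Localization.AtPrime J) z * algebraMap P _ a = 0 := by
        rw [← map_mul, hmem.mp hz, map_zero]
      rcases mul_eq_zero.mp hza with h0 | h0
      · simp [h0]
      · obtain ⟨c, hc⟩ := (IsLocalization.map_eq_zero_iff J.primeCompl _ _).mp h0
        exact absurd (hIJ (hmem.mpr hc)) c.2
    · obtain ⟨c, hcI, hcJ⟩ := Set.not_subset.mp hIJ
      refine ⟨c * z, Ideal.mul_mem_mul hcI hz, ⟨c, hcJ⟩, ?_⟩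
      rw [IsLocalizedModule.mk'_eq_iff]
      simp [Submonoid.smul_def, Algebra.smul_def]
  obtain ⟨e, he, hIe⟩ := (Ideal.isIdempotentElem_iff_of_fg I (IsNoetherian.noetherian I)).mp hI
  rcases h e he with rfl | rfl
  · right
    have : b ∈ I := hmem.mpr (by rw [mul_comm, hab])
    simpa [hIe] using this
  · left
    have : (1 : P) ∈ I := by rw [hIe]; exact Ideal.mem_span_singleton_self _
    simpa using hmem.mp this

end

/-! ### Integral elements over flat algebras with reduced fibres -/

section FlatNormal

variable {R C : Type*} [CommRing R] [CommRing C] [Algebra R C]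

/-- By flatness, `C ⧸ q C` embeds into the fibre `κ(q) ⊗ C`. -/
theorem Ideal.mem_map_of_pow_mem_map [Module.Flat R C] (q : Ideal R) [q.IsPrime]
    [IsReduced (q.Fiber C)] {c : C} {k : ℕ} (hc : c ^ k ∈ q.map (algebraMap R C)) :
    c ∈ q.map (algebraMap R C) := by
  let g : C →ₐ[R] q.Fiber C := Algebra.TensorProduct.includeRight
  have hq : ∀ z ∈ q.map (algebraMap R C), g z = 0 := by
    intro z hz
    have hle : q.map (algebraMap R C) ≤ RingHom.ker g.toRingHom := by
      rw [Ideal.map_le_iff_le_comap]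
      intro a ha
      have : algebraMap R q.ResidueField a = 0 := by simpa using ha
      change g (algebraMap R C a) = 0
      rw [AlgHom.commutes, Algebra.TensorProduct.algebraMap_apply, this, zero_tmul]
    exact hle hz
  have hgc : g c = 0 := by
    have : IsNilpotent (g c) := ⟨k, by rw [← map_pow, hq _ hc]⟩
    exact this.eq_zero
  have hinj : Function.Injective (LinearMap.rTensor C
      (IsScalarTower.toAlgHom R (R ⧸ q) q.ResidueField).toLinearMap) :=
    Module.Flat.rTensor_preserves_injective_linearMap _
      (q.injective_algebraMap_quotient_residueField)
  have h1 : (1 : R ⧸ q) ⊗ₜ[R] c = 0 := by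
    apply hinj
    rw [map_zero, LinearMap.rTensor_tmul]
    simpa [g] using hgc
  have h2 := congrArg (TensorProduct.quotTensorEquivQuotSMul C q) h1
  rw [map_zero, ← map_one (Ideal.Quotient.mk q),
    TensorProduct.quotTensorEquivQuotSMul_mk_tmul, one_smul, Submodule.Quotient.mk_eq_zero,
    Ideal.smul_top_eq_map] at h2
  exact h2

/-- Colon ideals of finitely generated ideals commute with flat base change. -/
theorem Module.Flat.mem_map_of_forall_mul_mem [Module.Flat R C] [IsNoetherianRing R] (q : Ideal R)
    {d : R} {J : Ideal R} (hJ : ∀ r, (∀ a ∈ q, a * r ∈ Ideal.span {d}) → r ∈ J) {c : C}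
    (hc : ∀ a ∈ q, algebraMap R C a * c ∈ Ideal.span {algebraMap R C d}) :
    c ∈ J.map (algebraMap R C) := by
  classical
  obtain ⟨s, hs⟩ := IsNoetherian.noetherian q
  let f : R →ₗ[R] (s → R ⧸ Ideal.span {d}) :=
    LinearMap.pi fun a => LinearMap.toSpanSingleton R _ (Ideal.Quotient.mk _ (a : R))
  have hker : LinearMap.ker f ≤ J := by
    intro r hr
    refine hJ r fun a ha => ?_
    rw [← hs] at ha
    have hle : Ideal.span (s : Set R) ≤
        Submodule.comap (LinearMap.mulRight R r) (Ideal.span {d}) := by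
      rw [Ideal.span_le]
      intro b hb
      have := congrFun (LinearMap.mem_ker.mp hr) ⟨b, hb⟩
      simp only [f, LinearMap.pi_apply, LinearMap.toSpanSingleton_apply, Pi.zero_apply,
        Algebra.smul_def, Ideal.Quotient.algebraMap_eq, ← map_mul] at this
      rw [Ideal.Quotient.eq_zero_iff_mem, mul_comm] at this
      exact this
    exact hle ha
  have hmem : c ⊗ₜ[R] (1 : R) ∈ LinearMap.ker (AlgebraTensorModule.lTensor C C f) := by
    rw [LinearMap.mem_ker, AlgebraTensorModule.lTensor_tmul]
    apply (TensorProduct.piRight R R C (fun _ : s => R ⧸ Ideal.span {d})).injective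
    rw [map_zero]
    ext a
    have ha : (a : R) ∈ q := hs ▸ Ideal.subset_span a.2
    obtain ⟨c', hc'⟩ := Ideal.mem_span_singleton'.mp (hc a ha)
    have h0 : (Ideal.Quotient.mk (Ideal.span {d}) d) = 0 :=
      Ideal.Quotient.eq_zero_iff_mem.mpr (Ideal.mem_span_singleton_self d)
    have hsm : ∀ b : R, Ideal.Quotient.mk (Ideal.span {d}) b =
        b • (1 : R ⧸ Ideal.span {d}) := fun b => by
      rw [Algebra.smul_def, mul_one]; rfl
    simp only [f, piRight_apply, piRightHom_tmul, LinearMap.pi_apply,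
      LinearMap.toSpanSingleton_apply, one_smul, Pi.zero_apply]
    rw [hsm, ← smul_tmul, Algebra.smul_def, ← hc', mul_comm, ← Algebra.smul_def, smul_tmul, ← hsm,
      h0, tmul_zero]
  rw [Module.Flat.ker_lTensor_eq] at hmem
  obtain ⟨t, ht⟩ := hmem
  have key : ∀ t : C ⊗[R] LinearMap.ker f, Algebra.TensorProduct.rid R C C
      (AlgebraTensorModule.lTensor C C (LinearMap.ker f).subtype t) ∈ J.map (algebraMap R C) := by
    intro t
    induction t with
    | zero => simp
    | add x y hx hy => rw [map_add, map_add]; exact Ideal.add_mem _ hx hy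
    | tmul x y =>
      simp only [AlgebraTensorModule.lTensor_tmul, Submodule.subtype_apply,
        Algebra.TensorProduct.rid_tmul, Algebra.smul_def]
      exact Ideal.mul_mem_right _ _ (Ideal.mem_map_of_mem _ (hker y.2))
  have := key t
  rw [ht] at this
  simpa using this

/-- If `q ≠ 0` is a finitely generated ideal of a normal domain with `q j ⊆ d q`, then `d ∣ j`. -/
theorem IsIntegrallyClosed.dvd_of_forall_mul_mem [IsDomain R] [IsNoetherianRing R]
    [IsIntegrallyClosed R] (K : Type*) [Field K] [Algebra R K] [IsFractionRing R K]
    {q : Ideal R} (hq : q ≠ ⊥) {d j : R} (hd : d ≠ 0)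
    (h : ∀ a ∈ q, ∃ u ∈ q, a * j = d * u) : d ∣ j := by
  have hd' : algebraMap R K d ≠ 0 := by simpa using hd
  have hint : IsIntegral R (algebraMap R K j / algebraMap R K d) := by
    refine isIntegral_of_smul_mem_submodule (M := K) (Submodule.map (Algebra.linearMap R K) q) ?_
      ((IsNoetherian.noetherian q).map _) _ ?_
    · intro h0
      exact hq (Submodule.map_injective_of_injective (f := Algebra.linearMap R K)
        (IsFractionRing.injective R K) (h0.trans (Submodule.map_bot _).symm))
    · rintro _ ⟨a, ha, rfl⟩
      obtain ⟨u, hu, hau⟩ := h a ha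
      refine ⟨u, hu, ?_⟩
      have := congrArg (algebraMap R K) hau
      rw [map_mul, map_mul] at this
      simp only [Algebra.linearMap_apply, smul_eq_mul]
      field_simp
      linear_combination -this
  obtain ⟨y, hy⟩ := IsIntegrallyClosed.algebraMap_eq_of_integral hint
  refine ⟨y, IsFractionRing.injective R K ?_⟩
  rw [map_mul, hy, mul_div_cancel₀ _ hd']

/-- Let `C` be flat with reduced fibres over the Noetherian normal domain `R`.  Then `C` is
integrally closed in `(R \ {0})⁻¹ C`.

Write an integral element as `x = c / d`.  If `d ∤ c`, replacing `x` by a multiple makes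
`q = {a ∈ R | a c ∈ d C}` a prime ideal; flatness and normality of `R` show that `q` is principal
locally at `q`, generated by some `a` such that, up to a unit, `a x` lies in `C`.  As `x` is
integral, a power of `a x` lies in `q C`, and `C ⧸ q C` is reduced. -/
theorem Module.Flat.mem_range_of_isIntegral [IsDomain R] [IsNoetherianRing R]
    [IsIntegrallyClosed R] [Module.Flat R C]
    (hred : ∀ (q : Ideal R) [q.IsPrime], IsReduced (q.Fiber C))
    {P : Type*} [CommRing P] [Algebra C P] [Algebra R P] [IsScalarTower R C P]
    (hinj : Function.Injective (algebraMap C P)) {x : P} (hx : IsIntegral C x) {d : R}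
    (hP : ∀ r : R, r ≠ 0 → IsUnit (algebraMap R P r)) (hd0 : d ≠ 0) {c : C}
    (hdx : algebraMap R P d * x = algebraMap C P c) :
    algebraMap R C d ∣ c := by
  by_contra hcon
  let I₀ : Ideal R := ((Ideal.span {algebraMap R C d}).restrictScalars R).comap
    (LinearMap.toSpanSingleton R C c)
  have hI₀ : ∀ r, r ∈ I₀ ↔ algebraMap R C d ∣ algebraMap R C r * c := fun r => by
    simp [I₀, Ideal.mem_span_singleton, Algebra.smul_def]
  have h1 : (1 : R ⧸ I₀) ≠ 0 := by
    rw [Ne, ← map_one (Ideal.Quotient.mk I₀), Ideal.Quotient.eq_zero_iff_mem, hI₀]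
    simpa using hcon
  obtain ⟨q, hq, -⟩ := exists_le_isAssociatedPrime_of_isNoetherianRing R (1 : R ⧸ I₀) h1
  rw [isAssociatedPrime_iff] at hq
  obtain ⟨hqp, y, hqy⟩ := hq
  obtain ⟨r, rfl⟩ := Ideal.Quotient.mk_surjective y
  -- replace `x` by `r x`
  obtain ⟨c₂, hc₂⟩ : ∃ c₂, c₂ = algebraMap R C r * c := ⟨_, rfl⟩
  have hmem : ∀ a, a ∈ q ↔ algebraMap R C d ∣ algebraMap R C a * c₂ := fun a => by
    rw [hqy, Submodule.mem_colon_singleton, Submodule.mem_bot, hc₂, ← mul_assoc, ← map_mul, ← hI₀,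
      ← Ideal.Quotient.eq_zero_iff_mem, map_mul, Algebra.smul_def]
    rfl
  obtain ⟨x₂, hx₂⟩ : ∃ x₂, x₂ = algebraMap R P r * x := ⟨_, rfl⟩
  have hint : IsIntegral C x₂ := by
    rw [hx₂, IsScalarTower.algebraMap_apply R C P]
    exact isIntegral_algebraMap.mul hx
  have hdx₂ : algebraMap R P d * x₂ = algebraMap C P c₂ := by
    rw [hx₂, hc₂, map_mul, ← hdx, ← IsScalarTower.algebraMap_apply]; ring
  have hdq : d ∈ q := (hmem d).mpr (Dvd.intro _ rfl)
  have hq0 : q ≠ ⊥ := fun h => hd0 (by rw [h] at hdq; exact hdq)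
  let J : Ideal R := (Ideal.span {d}).colon q
  have hJ : ∀ {j}, j ∈ J ↔ ∀ a ∈ q, d ∣ a * j := fun {j} => by
    simp [J, Submodule.mem_colon, Ideal.mem_span_singleton, mul_comm j]
  have hc₂J : c₂ ∈ J.map (algebraMap R C) := by
    refine Module.Flat.mem_map_of_forall_mul_mem (d := d) q (fun r hr => hJ.mpr fun a ha => ?_)
      fun a ha => ?_
    · exact Ideal.mem_span_singleton.mp (hr a ha)
    · exact Ideal.mem_span_singleton.mpr ((hmem a).mp ha)
  have h1q : (1 : R) ∉ q := fun h => hqp.ne_top ((Ideal.eq_top_iff_one q).mpr h)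
  obtain ⟨a, haq, j, hj, u, hu, hau⟩ : ∃ a ∈ q, ∃ j ∈ J, ∃ u, u ∉ q ∧ a * j = d * u := by
    by_contra! hno
    have hle : J ≤ Ideal.span {d} := fun j hj => Ideal.mem_span_singleton.mpr <|
      IsIntegrallyClosed.dvd_of_forall_mul_mem (FractionRing R) hq0 hd0 fun a ha => by
        obtain ⟨u, hu⟩ := hJ.mp hj a ha
        exact ⟨u, by_contra fun h => hno a ha j hj u h hu, hu⟩
    have := Ideal.map_mono (f := algebraMap R C) hle hc₂J
    rw [Ideal.map_span, Set.image_singleton, Ideal.mem_span_singleton] at this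
    exact h1q ((hmem 1).mpr (by simpa using this))
  have hu0 : u ≠ 0 := fun h => hu (h ▸ q.zero_mem)
  have ha0 : a ≠ 0 := by
    rintro rfl
    rw [zero_mul, eq_comm, mul_eq_zero] at hau
    exact hau.elim hd0 hu0
  -- `u J ⊆ (j)` and `u q ⊆ (a)`
  have huJ : ∀ j' ∈ J, j ∣ u * j' := fun j' hj' => by
    obtain ⟨w, hw⟩ := hJ.mp hj' a haq
    exact ⟨w, mul_left_cancel₀ ha0 (by linear_combination u * hw - w * hau)⟩
  have huq : ∀ b ∈ q, a ∣ u * b := fun b hb => by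
    obtain ⟨v, hv⟩ := hJ.mp hj b hb
    exact ⟨v, mul_left_cancel₀ hd0 (by linear_combination a * hv - b * hau)⟩
  have hsc : ∀ {I : Ideal R} {b z : R}, (∀ i ∈ I, b ∣ z * i) → ∀ {e : C},
      e ∈ I.map (algebraMap R C) → algebraMap R C b ∣ algebraMap R C z * e := by
    intro I b z h e he
    have hle : I.map (algebraMap R C) ≤ Submodule.comap
        (LinearMap.mulLeft C (algebraMap R C z)) (Ideal.span {algebraMap R C b}) := by
      rw [Ideal.map_le_iff_le_comap]
      intro i hi
      obtain ⟨w, hw⟩ := h i hi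
      change algebraMap R C z * algebraMap R C i ∈ Ideal.span {algebraMap R C b}
      rw [← map_mul, hw, map_mul]
      exact Ideal.mul_mem_right _ _ (Ideal.mem_span_singleton_self _)
    have hze : algebraMap R C z * e ∈ Ideal.span {algebraMap R C b} := hle he
    exact Ideal.mem_span_singleton.mp hze
  obtain ⟨c₁, hc₁⟩ := hsc huJ hc₂J
  have hac₁ : algebraMap C P (algebraMap R C a) * x₂ = algebraMap C P c₁ := by
    apply (hP _ (mul_ne_zero hd0 hu0)).mul_left_cancel
    have h3 := congrArg (algebraMap C P) hc₁
    have h4 := congrArg (algebraMap R P) hau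
    simp only [map_mul, ← IsScalarTower.algebraMap_apply] at h3 h4 ⊢
    linear_combination algebraMap R P u * algebraMap R P a * hdx₂ + algebraMap R P a * h3 +
      algebraMap C P c₁ * h4
  obtain ⟨N, hN⟩ : ∃ N, c₁ ^ N ∈ q.map (algebraMap R C) := by
    obtain ⟨p, hp, hpx⟩ := hint
    have hroot := Polynomial.scaleRoots_eval₂_eq_zero (s := algebraMap R C a) (algebraMap C P) hpx
    rw [hac₁, Polynomial.eval₂_hom, map_eq_zero_iff _ hinj, Polynomial.eval_eq_sum_range,
      Polynomial.natDegree_scaleRoots, Finset.sum_range_succ,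
      Polynomial.coeff_scaleRoots_natDegree, hp.leadingCoeff, one_mul] at hroot
    refine ⟨p.natDegree, ?_⟩
    rw [eq_neg_of_add_eq_zero_right hroot]
    refine (Ideal.map (algebraMap R C) q).neg_mem (Ideal.sum_mem _ fun i hi => ?_)
    rw [Polynomial.coeff_scaleRoots]
    refine Ideal.mul_mem_right _ _ (Ideal.mul_mem_left _ _ (Ideal.pow_mem_of_mem _
      (Ideal.mem_map_of_mem _ haq) _ ?_))
    have := Finset.mem_range.mp hi
    omega
  have hc₁q := Ideal.mem_map_of_pow_mem_map q hN
  obtain ⟨c₃, hc₃⟩ := hsc huq hc₁q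
  have huu : u * u ∈ q := by
    rw [hmem]
    refine ⟨algebraMap R C u * c₃, ?_⟩
    have hC := congrArg (algebraMap R C) hau
    simp only [map_mul] at hC ⊢
    linear_combination algebraMap R C u * hc₁ + algebraMap R C j * hc₃ + c₃ * hC
  exact hu ((hqp.mem_or_mem huu).elim id id)

end FlatNormal

/-! ### Completions of normal local rings -/

attribute [local instance] Algebra.TensorProduct.rightAlgebra in
/-- A local ring which is flat over a Noetherian normal domain, with regular fibres, is a domain:
every idempotent of its generic fibre is integral over it, hence lies in it. -/
theorem Module.Flat.isDomain_of_isRegularRing_fiber {R : Type*} {C : Type*} [CommRing R]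
    [CommRing C] [Algebra R C] [IsDomain R] [IsNoetherianRing R] [IsIntegrallyClosed R]
    [Module.Flat R C] [IsLocalRing C]
    (h : ∀ (q : Ideal R) [q.IsPrime], IsRegularRing (q.Fiber C)) : IsDomain C := by
  have hred : ∀ (q : Ideal R) [q.IsPrime], IsReduced (q.Fiber C) := fun q _ =>
    have := h q
    IsRegularRing.isReduced _
  let P := (⊥ : Ideal R).Fiber C
  have hκ : ∀ r : R, r ≠ 0 → algebraMap R (⊥ : Ideal R).ResidueField r ≠ 0 := fun r hr h0 =>
    hr (by simpa using h0)
  have hinj : Function.Injective (algebraMap C P) :=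
    Algebra.TensorProduct.includeRight_injective
      ((injective_iff_map_eq_zero _).mpr fun r hr => by_contra fun h0 => hκ r h0 hr)
  have hunit : ∀ r : R, r ≠ 0 → IsUnit (algebraMap R P r) := fun r hr =>
    (hκ r hr).isUnit.map (algebraMap (⊥ : Ideal R).ResidueField P)
  have hP : IsRegularRing P := h ⊥
  have hdom : NoZeroDivisors P := by
    refine IsRegularRing.noZeroDivisors fun e he => ?_
    obtain ⟨d, hd, c, hdc⟩ := Ideal.Fiber.exists_smul_eq_one_tmul (⊥ : Ideal R) e
    have hd0 : d ≠ 0 := by simpa using hd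
    have hint : IsIntegral C e := by
      refine ⟨Polynomial.X ^ 2 - Polynomial.X, Polynomial.monic_X_pow_sub (by simp), ?_⟩
      simp [pow_two, he.eq]
    obtain ⟨c', rfl⟩ := Module.Flat.mem_range_of_isIntegral hred hinj hint hunit hd0 (c := c)
      (by rw [← Algebra.smul_def, hdc]; rfl)
    have hec : e = algebraMap C P c' := by
      apply (hunit d hd0).mul_left_cancel
      rw [← Algebra.smul_def, hdc, IsScalarTower.algebraMap_apply R C P, ← map_mul]
      rfl
    have hc' : IsIdempotentElem c' := hinj (by rw [map_mul, ← hec, he.eq])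
    rcases IsLocalRing.isUnit_or_isUnit_one_sub_self c' with hu | hu
    · right
      rw [hec, (hu.mul_left_cancel (by rw [hc'.eq, mul_one]) : c' = 1), map_one]
    · left
      have : 1 - c' = 1 := hu.mul_left_cancel (by rw [hc'.one_sub.eq, mul_one])
      rw [hec, sub_eq_self.mp this, map_zero]
  have : NoZeroDivisors C := hinj.noZeroDivisors _ (map_zero _) (map_mul _)
  exact NoZeroDivisors.to_isDomain C

namespace LocalTheory

theorem HasGeometricallyRegularFormalFibers.isRegularRing_fiber {R : Type u} [CommRing R]
    [IsLocalRing R] (h : HasGeometricallyRegularFormalFibers R) (q : Ideal R) [q.IsPrime] :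
    IsRegularRing (q.Fiber (Completion R)) :=
  have := h q q.ResidueField inferInstance
  IsRegularRing.of_ringEquiv (R := q.ResidueField ⊗[q.ResidueField] q.Fiber (Completion R))
    (Algebra.TensorProduct.lid q.ResidueField (q.Fiber (Completion R))).toRingEquiv

/-- The completion of a normal local ring with geometrically regular formal fibres is a domain. -/
theorem isDomain_completion {R : Type u} [CommRing R] [IsDomain R] [IsLocalRing R]
    [IsNoetherianRing R] [IsIntegrallyClosed R] (h : HasGeometricallyRegularFormalFibers R) :
    IsDomain (Completion R) :=
  Module.Flat.isDomain_of_isRegularRing_fiber fun q _ => h.isRegularRing_fiber q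

end LocalTheory

/-! ### Completion of a localization of a finite algebra -/

theorem IsAdicComplete.of_linearEquiv {R M N : Type*} [CommRing R] (I : Ideal R) [AddCommGroup M]
    [Module R M] [AddCommGroup N] [Module R N] (e : M ≃ₗ[R] N) [IsAdicComplete I M] :
    IsAdicComplete I N := by
  rw [← AdicCompletion.of_bijective_iff]
  have : AdicCompletion.congr I e ∘ AdicCompletion.of I M ∘ e.symm = AdicCompletion.of I N := by
    funext x
    simp [AdicCompletion.congr, AdicCompletion.map_of]
  rw [← this]
  exact (AdicCompletion.congr I e).bijective.comp
    ((AdicCompletion.of_bijective I M).comp e.symm.bijective)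

theorem Ideal.sup_pow_le {R : Type*} [CommRing R] (I J : Ideal R) (i : ℕ) :
    (J ⊔ I) ^ i ≤ J ⊔ I ^ i := by
  induction i with
  | zero => simp
  | succ i ih =>
    calc (J ⊔ I) ^ (i + 1) = (J ⊔ I) ^ i * (J ⊔ I) := pow_succ _ _
      _ ≤ (J ⊔ I ^ i) * (J ⊔ I) := Ideal.mul_mono_left ih
      _ ≤ J ⊔ I ^ (i + 1) := by
        rw [Ideal.sup_mul, Ideal.mul_sup (I ^ i), ← pow_succ]
        have h1 : J * (J ⊔ I) ≤ J := Ideal.mul_le_left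
        have h2 : I ^ i * J ≤ J := Ideal.mul_le_right
        exact sup_le (h1.trans le_sup_left) (sup_le (h2.trans le_sup_left) le_sup_right)

namespace LocalTheory

section

variable {R : Type u} [CommRing R] [IsLocalRing R]

instance isAdicComplete_tensorProduct_completion [IsNoetherianRing R] (D : Type u) [CommRing D]
    [Algebra R D] [Module.Finite R D] : IsAdicComplete
      ((maximalIdeal R).map (algebraMap R (D ⊗[R] Completion R))) (D ⊗[R] Completion R) := by
  rw [IsAdicComplete.map_algebraMap_iff]
  have : IsAdicComplete (maximalIdeal R) (AdicCompletion (maximalIdeal R) D) :=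
    AdicCompletion.isAdicComplete (maximalIdeal R).fg_of_isNoetherianRing
  exact IsAdicComplete.of_linearEquiv _
    (((AdicCompletion.ofTensorProductEquivOfFiniteNoetherian
      (maximalIdeal R) D).restrictScalars R).symm ≪≫ₗ TensorProduct.comm R _ _)

/-- `R` is dense in `R̂`. -/
theorem exists_sub_mem_maximalIdeal_pow [IsNoetherianRing R] (j : ℕ) (y : Completion R) :
    ∃ r : R, y - algebraMap R (Completion R) r ∈
      (maximalIdeal R).map (algebraMap R (Completion R)) ^ j := by
  obtain ⟨r, hr⟩ := Submodule.Quotient.mk_surjective _ (AdicCompletion.eval (maximalIdeal R) R j y)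
  refine ⟨r, ?_⟩
  have h : y - algebraMap R (Completion R) r ∈
      (maximalIdeal R ^ j • (⊤ : Submodule R (Completion R))) := by
    rw [AdicCompletion.pow_smul_top_eq_ker_eval (maximalIdeal R).fg_of_isNoetherianRing,
      LinearMap.mem_ker, map_sub, ← hr, AdicCompletion.algebraMap_apply, AdicCompletion.eval_of]
    simp
  rw [Ideal.smul_top_eq_map, Ideal.map_pow] at h
  exact h

theorem mem_pow_of_algebraMap_mem {j : ℕ} {r : R}
    (h : algebraMap R (Completion R) r ∈
      (maximalIdeal R).map (algebraMap R (Completion R)) ^ j) : r ∈ maximalIdeal R ^ j := by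
  rw [← Ideal.map_pow] at h
  have hle : (maximalIdeal R ^ j).map (algebraMap R (Completion R)) ≤
      RingHom.ker (AdicCompletion.evalₐ (maximalIdeal R) j) := by
    rw [Ideal.map_le_iff_le_comap]
    intro a ha
    simpa [AdicCompletion.algebraMap_apply, Ideal.Quotient.eq_zero_iff_mem] using ha
  have := hle h
  simpa [AdicCompletion.algebraMap_apply, Ideal.Quotient.eq_zero_iff_mem] using this

/-- `D` is dense in `D ⊗ R̂` for the `m_R`-adic topology. -/
theorem exists_sub_mem_map_pow [IsNoetherianRing R] (D : Type u) [CommRing D] [Algebra R D] (j : ℕ)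
    (x : D ⊗[R] Completion R) : ∃ d : D, x - algebraMap D (D ⊗[R] Completion R) d ∈
      (maximalIdeal R).map (algebraMap R (D ⊗[R] Completion R)) ^ j := by
  induction x with
  | zero => exact ⟨0, by simp⟩
  | add x y hx hy =>
    obtain ⟨a, ha⟩ := hx
    obtain ⟨b, hb⟩ := hy
    refine ⟨a + b, ?_⟩
    rw [map_add, add_sub_add_comm]
    exact Ideal.add_mem _ ha hb
  | tmul d y =>
    obtain ⟨r, hr⟩ := exists_sub_mem_maximalIdeal_pow j y
    refine ⟨r • d, ?_⟩
    have h1 : d ⊗ₜ[R] y - algebraMap D (D ⊗[R] Completion R) (r • d) =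
        d ⊗ₜ[R] 1 * Algebra.TensorProduct.includeRight (A := D) (R := R)
          (y - algebraMap R (Completion R) r) := by
      rw [Algebra.TensorProduct.algebraMap_apply, Algebra.algebraMap_self_apply,
        Algebra.TensorProduct.includeRight_apply, Algebra.TensorProduct.tmul_mul_tmul, mul_one,
        one_mul, tmul_sub, Algebra.algebraMap_eq_smul_one, tmul_smul, smul_tmul']
    rw [h1]
    refine Ideal.mul_mem_left _ _ ?_
    have h2 := Ideal.mem_map_of_mem
      (Algebra.TensorProduct.includeRight (A := D) (R := R) (B := Completion R)) hr
    rw [Ideal.map_pow] at h2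
    rw [← Algebra.TensorProduct.includeRight.comp_algebraMap, ← Ideal.map_map]
    exact h2

variable {D : Type u} [CommRing D] [Algebra R D]
  {A : Type u} [CommRing A] [IsLocalRing A] [Algebra D A] [Algebra R A] [IsScalarTower R D A]
  [IsLocalHom (algebraMap R A)]

variable (R A) in
/-- The map `R̂ → Â` induced by `R → A`, as a homomorphism of `R`-algebras. -/
noncomputable def completionAlgHom : Completion R →ₐ[R] Completion A where
  __ := completionMap (algebraMap R A)
  commutes' r := completionMap_algebraMap (algebraMap R A) r

variable (R D A) in
/-- For `R → D → A` with `R → A` local, the natural map `D ⊗ R̂ → Â`. -/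
noncomputable def tensorCompletionMap : D ⊗[R] Completion R →ₐ[D] Completion A :=
  Algebra.TensorProduct.lift (Algebra.ofId D (Completion A)) (completionAlgHom R A)
    fun _ _ => Commute.all _ _

theorem tensorCompletionMap_tmul (d : D) (y : Completion R) :
    tensorCompletionMap R D A (d ⊗ₜ y) =
      algebraMap D (Completion A) d * completionMap (algebraMap R A) y :=
  Algebra.TensorProduct.lift_tmul _ _ _ _ _

theorem map_tensorCompletionMap :
    ((maximalIdeal R).map (algebraMap R (D ⊗[R] Completion R))).map (tensorCompletionMap R D A) =
      ((maximalIdeal R).map (algebraMap R A)).map (algebraMap A (Completion A)) := by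
  change Ideal.map (tensorCompletionMap R D A : D ⊗[R] Completion R →+* Completion A) _ = _
  rw [Ideal.map_map, Ideal.map_map]
  congr 1
  rw [IsScalarTower.algebraMap_eq R D (D ⊗[R] Completion R), ← RingHom.comp_assoc,
    AlgHom.comp_algebraMap, ← IsScalarTower.algebraMap_eq, ← IsScalarTower.algebraMap_eq]

end

end LocalTheory

/-- Idempotents lift along Henselian pairs. -/
theorem HenselianRing.exists_isIdempotentElem_sub_mem {E : Type*} [CommRing E] (I : Ideal E)
    [HenselianRing E I] {a : E} (ha : a * a - a ∈ I) : ∃ e, IsIdempotentElem e ∧ e - a ∈ I := by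
  obtain ⟨e, he, hed⟩ := HenselianRing.is_henselian (I := I) (Polynomial.X ^ 2 - Polynomial.X)
    (Polynomial.monic_X_pow_sub (Polynomial.degree_X_le.trans_lt (by norm_num))) a
    (by simpa [pow_two] using ha) (by
      -- `(2 a - 1) ^ 2 = 1 + 4 (a ^ 2 - a)`
      refine IsUnit.of_mul_eq_one (Ideal.Quotient.mk I (2 * a - 1)) ?_
      rw [← map_mul, ← map_one (Ideal.Quotient.mk I), Ideal.Quotient.mk_eq_mk_iff_sub_mem]
      simp only [Polynomial.derivative_sub, Polynomial.derivative_X_pow, Polynomial.derivative_X,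
        Polynomial.eval_sub, Polynomial.eval_mul, Polynomial.eval_C, Polynomial.eval_pow,
        Polynomial.eval_X, Polynomial.eval_one]
      have := Ideal.mul_mem_left I 4 ha
      convert this using 1
      push_cast
      ring)
  refine ⟨e, ?_, hed⟩
  have : e ^ 2 - e = 0 := by simpa using he
  rw [IsIdempotentElem, ← pow_two]
  exact sub_eq_zero.mp this

namespace LocalTheory

section

variable {R : Type u} [CommRing R] [IsLocalRing R]
  {D : Type u} [CommRing D] [Algebra R D] [Module.Finite R D]

theorem map_maximalIdeal_le (n : Ideal D) [n.IsMaximal] :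
    (maximalIdeal R).map (algebraMap R D) ≤ n := by
  rw [Ideal.map_le_iff_le_comap]
  exact (eq_maximalIdeal (Ideal.isMaximal_comap_of_isIntegral_of_isMaximal n)).ge

/-- In the Artinian ring `D ⧸ m_R D` some power of `n` is generated by an idempotent, the image of
the element `d`. -/
theorem exists_mem_idempotent_mod (n : Ideal D) [n.IsMaximal] :
    ∃ d ∈ n, d * d - d ∈ (maximalIdeal R).map (algebraMap R D) ∧
      ∃ k ≠ 0, n ^ k ≤ Ideal.span {d} ⊔ (maximalIdeal R).map (algebraMap R D) := by
  let I := (maximalIdeal R).map (algebraMap R D)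
  have hI : I ≤ n := map_maximalIdeal_le n
  have : Module.Finite (R ⧸ maximalIdeal R) (D ⧸ I) :=
    Module.Finite.of_restrictScalars_finite R _ _
  have : IsArtinianRing (R ⧸ maximalIdeal R) :=
    inferInstanceAs (IsArtinianRing (ResidueField R))
  have : IsArtinianRing (D ⧸ I) := IsArtinianRing.of_finite (R ⧸ maximalIdeal R) _
  let n' := n.map (Ideal.Quotient.mk I)
  obtain ⟨k, hk⟩ := IsArtinian.monotone_stabilizes (R := D ⧸ I) (M := D ⧸ I)
    ⟨fun k => OrderDual.toDual (n' ^ k), fun a b hab => Ideal.pow_le_pow_right hab⟩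
  have hk' : ∀ m, k ≤ m → n' ^ k = n' ^ m := fun m hm => hk m hm
  have hidem : IsIdempotentElem (n' ^ (k + 1)) := by
    rw [IsIdempotentElem, ← pow_add, ← hk' (k + 1) (by omega), ← hk' (k + 1 + (k + 1)) (by omega)]
  obtain ⟨e, he, hne⟩ := (Ideal.isIdempotentElem_iff_of_fg _
    (IsNoetherian.noetherian (n' ^ (k + 1)))).mp hidem
  obtain ⟨d, rfl⟩ := Ideal.Quotient.mk_surjective e
  refine ⟨d, ?_, ?_, k + 1, by omega, ?_⟩
  · have h1 : Ideal.Quotient.mk I d ∈ n' := by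
      refine Ideal.pow_le_self (n := k + 1) (by omega) ?_
      rw [hne]; exact Ideal.mem_span_singleton_self _
    rw [Ideal.mem_quotient_iff_mem hI] at h1
    exact h1
  · rw [← Ideal.Quotient.eq_zero_iff_mem, map_sub, map_mul, he.eq, sub_self]
  · intro z hz
    have h1 : Ideal.Quotient.mk I z ∈ (Ideal.span {d}).map (Ideal.Quotient.mk I) := by
      rw [Ideal.map_span, Set.image_singleton]
      change _ ∈ Submodule.span _ _
      rw [← hne, ← Ideal.map_pow]
      exact Ideal.mem_map_of_mem _ hz
    rw [Ideal.mem_map_iff_of_surjective _ Ideal.Quotient.mk_surjective] at h1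
    obtain ⟨w, hw, hwz⟩ := h1
    rw [Ideal.Quotient.mk_eq_mk_iff_sub_mem] at hwz
    have : z = w - (w - z) := by ring
    rw [this]
    exact Ideal.sub_mem _ (Ideal.mem_sup_left hw) (Ideal.mem_sup_right hwz)

variable {A : Type u} [CommRing A] [IsLocalRing A] [Algebra D A] [Algebra R A]
  [IsScalarTower R D A] [IsLocalHom (algebraMap R A)]

/-- Let `A` be the localization of the finite `R`-algebra `D` at a maximal ideal.  Then `Â` is a
direct factor of the complete semilocal ring `D ⊗ R̂`: the map `D ⊗ R̂ → Â` is surjective and its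
kernel is generated by an idempotent. -/
theorem tensorCompletionMap_surjective_and_ker [IsNoetherianRing R] (n : Ideal D) [n.IsMaximal]
    [IsLocalization.AtPrime A n] :
    Function.Surjective (tensorCompletionMap R D A) ∧
      ∃ e, IsIdempotentElem e ∧ RingHom.ker (tensorCompletionMap R D A) = Ideal.span {e} := by
  have : IsNoetherianRing D := IsNoetherianRing.of_finite R D
  have : IsNoetherianRing A := IsLocalization.isNoetherianRing n.primeCompl A inferInstance
  obtain ⟨d, hdn, hdd, k, hk0, hk⟩ := exists_mem_idempotent_mod (R := R) n
  let E := D ⊗[R] Completion R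
  let φ := tensorCompletionMap R D A
  let I := (maximalIdeal R).map (algebraMap R D)
  let IE : Ideal E := (maximalIdeal R).map (algebraMap R E)
  have hIE : I.map (algebraMap D E) = IE := by
    rw [Ideal.map_map, ← IsScalarTower.algebraMap_eq]
  let IA := (maximalIdeal R).map (algebraMap R A)
  have hIA : I.map (algebraMap D A) = IA := by
    rw [Ideal.map_map, ← IsScalarTower.algebraMap_eq]
  have hnA : n.map (algebraMap D A) = maximalIdeal A :=
    IsLocalization.AtPrime.map_eq_maximalIdeal n A
  have hIAm : IA ≤ maximalIdeal A := by
    rw [← hIA, ← hnA]; exact Ideal.map_mono (map_maximalIdeal_le n)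
  let Â := Completion A
  have hmA : maximalIdeal Â = (maximalIdeal A).map (algebraMap A Â) :=
    AdicCompletion.maximalIdeal_eq_map
  have hφd : ∀ z : D, φ (algebraMap D E z) = algebraMap A Â (algebraMap D A z) := fun z => by
    rw [AlgHom.commutes, ← IsScalarTower.algebraMap_apply]
  have hφI : IE.map φ = IA.map (algebraMap A Â) := map_tensorCompletionMap
  have hmem : ∀ z ∈ n, algebraMap D A z ∈ maximalIdeal A := fun z hz => by
    rw [← hnA]; exact Ideal.mem_map_of_mem _ hz
  -- the idempotent
  obtain ⟨e, he, hed⟩ : ∃ e : E, IsIdempotentElem e ∧ e - algebraMap D E d ∈ IE := by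
    have hddE : algebraMap D E d * algebraMap D E d - algebraMap D E d ∈ IE := by
      rw [← map_mul, ← map_sub, ← hIE]; exact Ideal.mem_map_of_mem _ hdd
    exact HenselianRing.exists_isIdempotentElem_sub_mem IE hddE
  have hφe : φ e = 0 := by
    have h1 : φ e ∈ maximalIdeal Â := by
      have h2 : φ (e - algebraMap D E d) ∈ maximalIdeal Â := by
        have := Ideal.mem_map_of_mem φ hed
        rw [hφI] at this
        rw [hmA]
        exact Ideal.map_mono hIAm this
      rw [map_sub, hφd] at h2
      have h3 : algebraMap A Â (algebraMap D A d) ∈ maximalIdeal Â := by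
        rw [hmA]; exact Ideal.mem_map_of_mem _ (hmem d hdn)
      simpa using Ideal.add_mem _ h2 h3
    have hu : IsUnit (1 - φ e) := by
      by_contra hcon
      refine (Ideal.ne_top_iff_one _).mp (maximalIdeal.isMaximal Â).ne_top ?_
      have := Ideal.add_mem _ h1 ((mem_maximalIdeal _).mpr hcon)
      rwa [add_sub_cancel] at this
    have : φ e * φ e = φ e := by rw [← map_mul, he.eq]
    exact hu.mul_left_cancel (by rw [mul_zero]; linear_combination -this)
  have hpow : (n ^ k).map (algebraMap D E) ≤ Ideal.span {e} ⊔ IE := by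
    refine (Ideal.map_mono hk).trans ?_
    rw [Ideal.map_sup, hIE, Ideal.map_span, Set.image_singleton]
    refine sup_le ?_ le_sup_right
    rw [Ideal.span_singleton_le_iff_mem]
    have : algebraMap D E d = e - (e - algebraMap D E d) := by ring
    rw [this]
    exact Ideal.sub_mem _ (Ideal.mem_sup_left (Ideal.mem_span_singleton_self _))
      (Ideal.mem_sup_right hed)
  refine ⟨?_, e, he, le_antisymm ?_ ?_⟩
  · -- surjectivity
    have hkA : maximalIdeal A ^ k ≤ IA := by
      rw [← hnA, ← Ideal.map_pow]
      refine (Ideal.map_mono hk).trans ?_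
      rw [Ideal.map_sup, hIA, Ideal.map_span, Set.image_singleton]
      refine sup_le ?_ le_rfl
      rw [Ideal.span_singleton_le_iff_mem]
      have hu : IsUnit (algebraMap D A d - 1) := by
        by_contra hcon
        refine (Ideal.ne_top_iff_one _).mp (maximalIdeal.isMaximal A).ne_top ?_
        have := Ideal.sub_mem _ (hmem d hdn) ((mem_maximalIdeal _).mpr hcon)
        rwa [sub_sub_cancel] at this
      rw [← Ideal.unit_mul_mem_iff_mem _ hu, ← hIA]
      have := Ideal.mem_map_of_mem (algebraMap D A) hdd
      rw [map_sub, map_mul] at this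
      convert this using 1
      ring
    have hhaus : IsHausdorff (IE.map φ.toRingHom) Â := by
      have hle : IE.map φ.toRingHom ≤ maximalIdeal Â := by
        rw [hmA]; exact hφI.le.trans (Ideal.map_mono hIAm)
      refine ⟨fun x hx => IsHausdorff.haus (I := maximalIdeal Â) inferInstance x fun i => ?_⟩
      exact (hx i).mono (Submodule.smul_mono_left (Ideal.pow_right_mono hle i))
    refine surjective_of_mk_map_comp_surjective (I := IE) φ.toRingHom fun y => ?_
    obtain ⟨y, rfl⟩ := Ideal.Quotient.mk_surjective y
    obtain ⟨a, ha⟩ := exists_sub_mem_maximalIdeal_pow k y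
    obtain ⟨z, hz⟩ := Ideal.Quotient.mk_surjective
      ((IsLocalization.AtPrime.equivQuotMaximalIdealPow n A k).symm (Ideal.Quotient.mk _ a))
    rw [AlgEquiv.eq_symm_apply, IsLocalization.AtPrime.equivQuotMaximalIdealPow_apply_mk,
      Ideal.Quotient.mk_eq_mk_iff_sub_mem] at hz
    refine ⟨algebraMap D E z, ?_⟩
    rw [RingHom.comp_apply, Ideal.Quotient.mk_eq_mk_iff_sub_mem]
    change φ (algebraMap D E z) - y ∈ IE.map φ
    rw [hφd, hφI]
    rw [← Ideal.map_pow] at ha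
    have h1 := Ideal.map_mono (f := algebraMap A Â) hkA ha
    have h2 := Ideal.mem_map_of_mem (algebraMap A Â) (hkA hz)
    rw [map_sub] at h2
    have := Ideal.sub_mem _ h2 h1
    convert this using 1
    ring
  · -- an element of the kernel is in `(e) + m_R ^ i E` for all `i`
    intro x hx
    have hx0 : φ x = 0 := hx
    have hall : ∀ i, x ∈ Ideal.span {e} ⊔ IE ^ i := by
      intro i
      obtain ⟨z, hz⟩ := exists_sub_mem_map_pow D (k * i) x
      have h1 := Ideal.mem_map_of_mem φ hz
      change φ (x - algebraMap D E z) ∈ (IE ^ (k * i)).map φ at h1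
      rw [map_sub, hx0, hφd, zero_sub, neg_mem_iff, Ideal.map_pow, hφI] at h1
      have h2 := mem_pow_of_algebraMap_mem
        (Ideal.pow_right_mono (Ideal.map_mono (f := algebraMap A Â) hIAm) _ h1)
      have h3 : z ∈ n ^ (k * i) := by
        rw [← Ideal.Quotient.eq_zero_iff_mem,
          ← map_eq_zero_iff _
            (IsLocalization.AtPrime.equivQuotMaximalIdealPow n A (k * i)).injective,
          IsLocalization.AtPrime.equivQuotMaximalIdealPow_apply_mk,
          Ideal.Quotient.eq_zero_iff_mem]
        exact h2
      have h4 : algebraMap D E z ∈ Ideal.span {e} ⊔ IE ^ i := by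
        refine Ideal.sup_pow_le _ _ _ (Ideal.pow_right_mono hpow i ?_)
        rw [← Ideal.map_pow, ← pow_mul]
        exact Ideal.mem_map_of_mem _ h3
      have h5 : x - algebraMap D E z ∈ Ideal.span {e} ⊔ IE ^ i :=
        Ideal.mem_sup_right (Ideal.pow_le_pow_right (Nat.le_mul_of_pos_left i (by omega)) hz)
      simpa using Ideal.add_mem _ h5 h4
    have h0 : (1 - e) * x = 0 := by
      refine IsHausdorff.haus (I := IE) inferInstance _ fun i => ?_
      rw [SModEq.zero, smul_eq_mul, Ideal.mul_top]
      obtain ⟨a, ha, b, hb, hab⟩ := Submodule.mem_sup.mp (hall i)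
      obtain ⟨c, rfl⟩ := Ideal.mem_span_singleton'.mp ha
      rw [← hab, mul_add]
      refine Ideal.add_mem _ ?_ (Ideal.mul_mem_left _ _ hb)
      have : (1 - e) * (c * e) = 0 := by linear_combination -c * he.eq
      rw [this]; exact Ideal.zero_mem _
    rw [Ideal.mem_span_singleton']
    exact ⟨x, by linear_combination -h0⟩
  · rw [Ideal.span_singleton_le_iff_mem]
    exact hφe

end

end LocalTheory

/-! ### Excellence of localizations of finite algebras -/

theorem IsRegularRing.tensorProduct_of_surjective {D E C : Type*} (k : Type*) [CommRing D]
    [CommRing E] [CommRing C] [CommRing k] [Algebra D k] [Algebra D E] [Algebra D C]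
    [IsRegularRing (k ⊗[D] E)] (φ : E →ₐ[D] C) (hφ : Function.Surjective φ) {e : E}
    (he : IsIdempotentElem e) (hker : RingHom.ker φ = Ideal.span {e}) :
    IsRegularRing (k ⊗[D] C) := by
  let f : k ⊗[D] E →ₐ[D] k ⊗[D] C := Algebra.TensorProduct.map (AlgHom.id D k) φ
  have hf : Function.Surjective f :=
    Algebra.TensorProduct.map_surjective _ _ Function.surjective_id hφ
  let g : E →ₐ[D] k ⊗[D] E := Algebra.TensorProduct.includeRight
  have hg : IsIdempotentElem (g e) := by
    have := congrArg g he
    rwa [map_mul] at this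
  have hk : RingHom.ker f = Ideal.span {g e} := by
    rw [Algebra.TensorProduct.lTensor_ker _ hφ, hker, Ideal.map_span, Set.image_singleton]
  exact IsRegularRing.of_surjective_of_ker_eq_span (f := f.toRingHom) hf hg hk

/-- A local ring of `D` that contains a localization `D'` of `D` is a local ring of `D'`. -/
theorem IsLocalization.AtPrime.of_isScalarTower {D : Type*} [CommRing D] (N : Submonoid D)
    (D' : Type*) {A : Type*} [CommRing D'] [CommRing A] [IsLocalRing A] [Algebra D D']
    [Algebra D' A] [Algebra D A] [IsScalarTower D D' A] [IsLocalization N D']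
    (q : Ideal D) [q.IsPrime]
    [IsLocalization.AtPrime A q] (hle : N ≤ q.primeCompl) :
    IsLocalization.AtPrime A ((maximalIdeal A).comap (algebraMap D' A)) := by
  have hmem : ∀ d : D, d ∈ q ↔ algebraMap D' A (algebraMap D D' d) ∈ maximalIdeal A := fun d => by
    rw [← IsScalarTower.algebraMap_apply, IsLocalization.AtPrime.to_map_mem_maximal_iff A q]
  have := IsLocalization.isLocalization_of_submonoid_le D' A N q.primeCompl hle
  refine IsLocalization.isLocalization_of_is_exists_mul_mem A (q.primeCompl.map (algebraMap D D')) _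
    ?_ ?_
  · rintro _ ⟨d, hd, rfl⟩
    exact fun h => hd ((hmem d).mpr h)
  · rintro ⟨x, hx⟩
    obtain ⟨⟨d, s⟩, hs⟩ := IsLocalization.surj N x
    refine ⟨algebraMap D D' s, d, fun hd => ?_, by rw [mul_comm]; exact hs.symm⟩
    have h1 : x * algebraMap D D' s ∈ (maximalIdeal A).comap (algebraMap D' A) := by
      rw [hs]
      exact (hmem d).mp hd
    refine (Ideal.IsPrime.mem_or_mem inferInstance h1).elim hx fun h => ?_
    exact hle s.2 ((hmem _).mpr h)

namespace LocalTheory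

section

variable {R : Type u} [CommRing R] [IsLocalRing R]
  {D : Type u} [CommRing D] [Algebra R D] [Module.Finite R D]
  {A : Type u} [CommRing A] [IsLocalRing A] [Algebra D A] [Algebra R A]
  [IsScalarTower R D A]

theorem isLocalHom_algebraMap_of_finite (n : Ideal D) [n.IsMaximal]
    [IsLocalization.AtPrime A n] : IsLocalHom (algebraMap R A) := by
  refine ((local_hom_TFAE (algebraMap R A)).out 0 2).mpr ?_
  rw [IsScalarTower.algebraMap_eq R D A, ← Ideal.map_map,
    ← IsLocalization.AtPrime.map_eq_maximalIdeal n A]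
  exact Ideal.map_mono (map_maximalIdeal_le n)

variable [IsLocalHom (algebraMap R A)]

/-- As `Â` is a direct factor of `D ⊗ R̂`, `k ⊗ Â` is a direct factor of `k ⊗ R̂` for each
`A`-algebra `k`. -/
theorem isRegularRing_tensorProduct_completion [IsNoetherianRing R] (n : Ideal D) [n.IsMaximal]
    [IsLocalization.AtPrime A n] (k : Type u) [CommRing k] [Algebra R k] [Algebra D k]
    [Algebra A k] [IsScalarTower R D k] [IsScalarTower D A k]
    [IsRegularRing (k ⊗[R] Completion R)] : IsRegularRing (k ⊗[A] Completion A) := by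
  obtain ⟨hsurj, e, he, hker⟩ := tensorCompletionMap_surjective_and_ker (A := A) (R := R) n
  have h1 : IsRegularRing (k ⊗[D] (D ⊗[R] Completion R)) :=
    .of_ringEquiv (Algebra.TensorProduct.cancelBaseChange R D D k (Completion R)).symm.toRingEquiv
  have h2 : IsRegularRing (k ⊗[D] Completion A) :=
    .tensorProduct_of_surjective k _ hsurj he hker
  exact .of_ringEquiv (IsLocalization.algebraTensorEquiv n.primeCompl A k
    (Completion A)).symm.toRingEquiv

/-- A finite extension `k` of the residue field of a prime of `A` is also finite over the residue
field of the prime below in `R`, so `k ⊗ Â` is a direct factor of the regular ring `k ⊗ R̂`. -/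
theorem HasGeometricallyRegularFormalFibers.of_finite [IsNoetherianRing R]
    (h : HasGeometricallyRegularFormalFibers R) (n : Ideal D) [n.IsMaximal]
    [IsLocalization.AtPrime A n] : HasGeometricallyRegularFormalFibers A := by
  intro Q _ k _ _ _
  let P := Q.under R
  let := Localization.AtPrime.algebraOfLiesOver P Q
  have : Algebra.QuasiFinite R A := Algebra.QuasiFinite.of_isLocalization (S := D) n.primeCompl
  have : Algebra.QuasiFinite P.ResidueField Q.ResidueField :=
    Algebra.QuasiFinite.of_restrictScalars R _ _
  have : Module.Finite P.ResidueField Q.ResidueField := .of_quasiFinite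
  let : Algebra P.ResidueField k := Algebra.compHom k (algebraMap P.ResidueField Q.ResidueField)
  have : IsScalarTower P.ResidueField Q.ResidueField k := .of_algebraMap_eq' rfl
  have : FiniteDimensional P.ResidueField k := Module.Finite.trans Q.ResidueField k
  let : Algebra A k := Algebra.compHom k (algebraMap A Q.ResidueField)
  have : IsScalarTower A Q.ResidueField k := .of_algebraMap_eq' rfl
  let : Algebra D k := Algebra.compHom k (algebraMap D A)
  have : IsScalarTower D A k := .of_algebraMap_eq' rfl
  let : Algebra R k := Algebra.compHom k (algebraMap R D)
  have : IsScalarTower R D k := .of_algebraMap_eq' rfl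
  have : IsScalarTower R P.ResidueField k := .of_algebraMap_eq' (by
    rw [IsScalarTower.algebraMap_eq R D k, IsScalarTower.algebraMap_eq D A k,
      IsScalarTower.algebraMap_eq A Q.ResidueField k,
      IsScalarTower.algebraMap_eq P.ResidueField Q.ResidueField k, RingHom.comp_assoc,
      RingHom.comp_assoc, RingHom.comp_assoc, ← IsScalarTower.algebraMap_eq R D A,
      ← IsScalarTower.algebraMap_eq R A, ← IsScalarTower.algebraMap_eq R P.ResidueField])
  have h1 := h P k inferInstance
  have : IsRegularRing (k ⊗[R] Completion R) :=
    .of_ringEquiv (R := k ⊗[P.ResidueField] P.Fiber (Completion R))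
      (Algebra.TensorProduct.cancelBaseChange R P.ResidueField k k (Completion R)).toRingEquiv
  have := isRegularRing_tensorProduct_completion (R := R) (A := A) n k
  exact .of_ringEquiv (R := k ⊗[A] Completion A)
    (Algebra.TensorProduct.cancelBaseChange A Q.ResidueField k k (Completion A)).symm.toRingEquiv

end

section

variable {R : Type u} [CommRing R] {D : Type u} [CommRing D] [Algebra R D] [Module.Finite R D]

/-- The property of being a G-ring passes to local rings of finite algebras. -/
theorem IsGRing.hasGeometricallyRegularFormalFibers [IsNoetherianRing R] (h : IsGRing R)
    {A : Type u} [CommRing A] [IsLocalRing A] [Algebra D A] (q : Ideal D) [q.IsPrime]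
    [IsLocalization.AtPrime A q] : HasGeometricallyRegularFormalFibers A := by
  -- pass to the finite algebra `D_p` over the local ring `R_p`
  let p := q.under R
  let Rp := Localization.AtPrime p
  let Dp := Localization (Algebra.algebraMapSubmonoid D p.primeCompl)
  have hle : Algebra.algebraMapSubmonoid D p.primeCompl ≤ q.primeCompl := by
    rintro _ ⟨r, hr, rfl⟩
    exact hr
  let : Algebra Dp A := IsLocalization.localizationAlgebraOfSubmonoidLe Dp A _ _ hle
  have : IsScalarTower D Dp A :=
    IsLocalization.localization_isScalarTower_of_submonoid_le _ _ _ _ hle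
  have : Module.Finite Rp Dp := Module.Finite.of_isLocalization R D p.primeCompl
  let : Algebra Rp A := Algebra.compHom A (algebraMap Rp Dp)
  have : IsScalarTower Rp Dp A := .of_algebraMap_eq' rfl
  have := IsLocalization.AtPrime.of_isScalarTower (A := A) _ Dp q hle
  let n := (maximalIdeal A).comap (algebraMap Dp A)
  have : n.IsMaximal := by
    refine Ideal.isMaximal_of_isIntegral_of_isMaximal_comap (R := Rp) _ ?_
    have h1 : maximalIdeal Rp ≤ n.comap (algebraMap Rp Dp) := by
      rw [← IsLocalization.AtPrime.map_eq_maximalIdeal p Rp, Ideal.map_le_iff_le_comap]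
      intro r hr
      change algebraMap Dp A (algebraMap Rp Dp (algebraMap R Rp r)) ∈ maximalIdeal A
      rw [← IsScalarTower.algebraMap_apply R Rp Dp, IsScalarTower.algebraMap_apply R D Dp,
        ← IsScalarTower.algebraMap_apply D Dp A, IsLocalization.AtPrime.to_map_mem_maximal_iff A q]
      exact hr
    rw [← (maximalIdeal.isMaximal Rp).eq_of_le (Ideal.IsPrime.ne_top inferInstance) h1]
    infer_instance
  have := isLocalHom_algebraMap_of_finite (R := Rp) (A := A) n
  exact HasGeometricallyRegularFormalFibers.of_finite (R := Rp) (h p) n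

end

end LocalTheory

/-- An algebra of finite type over a localization of `D` is a localization of an algebra of finite
type over `D`. -/
theorem IsLocalization.exists_subalgebra_finiteType {D S B : Type*} [CommRing D] [CommRing S]
    [CommRing B] [Algebra D S] [Algebra S B] [Algebra D B] [IsScalarTower D S B]
    (N : Submonoid D) [IsLocalization N S] [Algebra.FiniteType S B] :
    ∃ B₀ : Subalgebra D B, Algebra.FiniteType D B₀ ∧
      IsLocalization (Algebra.algebraMapSubmonoid B₀ N) B := by
  obtain ⟨s, hs⟩ := Algebra.FiniteType.out (R := S) (A := B)
  have hunit : ∀ m : N, IsUnit (algebraMap D B m) := fun m => by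
    rw [IsScalarTower.algebraMap_apply D S B]
    exact (IsLocalization.map_units S m).map _
  refine ⟨Algebra.adjoin D s, (Subalgebra.fg_iff_finiteType _).mp ⟨s, rfl⟩, ?_⟩
  refine ⟨?_, fun b => ?_, fun {x y} h => ⟨1, by rw [Subtype.ext h]⟩⟩
  · rintro ⟨_, m, hm, rfl⟩
    exact hunit ⟨m, hm⟩
  · have hb : b ∈ Algebra.adjoin S (s : Set B) := hs ▸ Algebra.mem_top
    have key : ∃ m : N, (m : D) • b ∈ Algebra.adjoin D (s : Set B) := by
      induction hb using Algebra.adjoin_induction with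
      | mem x hx => exact ⟨1, by simpa using Algebra.subset_adjoin hx⟩
      | algebraMap x =>
        obtain ⟨⟨d, m⟩, h⟩ := IsLocalization.surj N x
        refine ⟨m, ?_⟩
        rw [Algebra.smul_def, IsScalarTower.algebraMap_apply D S B, ← map_mul, mul_comm, h,
          ← IsScalarTower.algebraMap_apply]
        exact Subalgebra.algebraMap_mem _ d
      | add x y _ _ hx hy =>
        obtain ⟨m, hm⟩ := hx
        obtain ⟨l, hl⟩ := hy
        refine ⟨m * l, ?_⟩
        have : ((m * l : N) : D) • (x + y) = (l : D) • (m : D) • x + (m : D) • (l : D) • y := by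
          rw [smul_smul, smul_smul, smul_add, Submonoid.coe_mul, mul_comm (l : D)]
        rw [this]
        exact add_mem (Subalgebra.smul_mem _ hm _) (Subalgebra.smul_mem _ hl _)
      | mul x y _ _ hx hy =>
        obtain ⟨m, hm⟩ := hx
        obtain ⟨l, hl⟩ := hy
        refine ⟨m * l, ?_⟩
        rw [Submonoid.coe_mul, ← smul_mul_smul_comm]
        exact mul_mem hm hl
    obtain ⟨m, hm⟩ := key
    refine ⟨(⟨_, hm⟩, ⟨_, m, m.2, rfl⟩), ?_⟩
    change b * algebraMap D B m = (m : D) • b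
    rw [Algebra.smul_def, mul_comm]

namespace LocalTheory

section

variable {B₀ B : Type*} [CommRing B₀] [CommRing B] [Algebra B₀ B]

theorem IsCatenary.of_isLocalization (N : Submonoid B₀) [IsLocalization N B]
    (h : IsCatenary B₀) : IsCatenary B := by
  -- the spectrum of `B` is a lower set in the spectrum of `B₀`, so saturated chains are preserved
  let f : PrimeSpectrum B ↪o PrimeSpectrum B₀ :=
    OrderEmbedding.ofMapLEIff (PrimeSpectrum.comap (algebraMap B₀ B)) fun p q => by
      refine ⟨fun hpq => ?_, fun hpq => Ideal.comap_mono hpq⟩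
      have := Ideal.map_mono (f := algebraMap B₀ B) hpq
      change Ideal.map _ (p.asIdeal.under B₀) ≤ Ideal.map _ (q.asIdeal.under B₀) at this
      rwa [IsLocalization.map_under N, IsLocalization.map_under N] at this
  have hf : (Set.range f).OrdConnected := by
    refine IsLowerSet.ordConnected fun p q hqp hp => ?_
    change p ∈ Set.range (PrimeSpectrum.comap (algebraMap B₀ B)) at hp
    change q ∈ Set.range (PrimeSpectrum.comap (algebraMap B₀ B))
    rw [PrimeSpectrum.localization_comap_range B N] at hp ⊢
    exact Set.disjoint_of_subset_right hqp hp
  let φ : SetRel.Hom {(p, q) : PrimeSpectrum B × PrimeSpectrum B | p ⋖ q}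
      {(p, q) : PrimeSpectrum B₀ × PrimeSpectrum B₀ | p ⋖ q} :=
    ⟨f, fun hpq => CovBy.image f hpq hf⟩
  intro c d hh hl
  exact h (c.map φ) (d.map φ) (by simp [hh]) (by simp [hl])

/-- Localization does not change local rings, so the regular locus of `B` is the preimage of that of
`B₀`. -/
theorem isOpen_regularLocus_of_isLocalization (N : Submonoid B₀) [IsLocalization N B]
    (h : IsOpen {x : PrimeSpectrum B₀ | IsRegularLocalRing (Localization.AtPrime x.asIdeal)}) :
    IsOpen {x : PrimeSpectrum B | IsRegularLocalRing (Localization.AtPrime x.asIdeal)} := by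
  convert h.preimage (PrimeSpectrum.continuous_comap (algebraMap B₀ B)) using 1
  ext x
  have : IsLocalization.AtPrime (Localization.AtPrime x.asIdeal)
      (PrimeSpectrum.comap (algebraMap B₀ B) x).asIdeal :=
    IsLocalization.isLocalization_isLocalization_atPrime_isLocalization N _ x.asIdeal
  let e := (IsLocalization.algEquiv (PrimeSpectrum.comap (algebraMap B₀ B) x).asIdeal.primeCompl
    (Localization.AtPrime (PrimeSpectrum.comap (algebraMap B₀ B) x).asIdeal)
    (Localization.AtPrime x.asIdeal)).toRingEquiv
  exact ⟨fun (_ : IsRegularLocalRing (Localization.AtPrime x.asIdeal)) => .of_ringEquiv e.symm,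
    fun (_ : IsRegularLocalRing (Localization.AtPrime
      (PrimeSpectrum.comap (algebraMap B₀ B) x).asIdeal)) => .of_ringEquiv e⟩

end

/-- Localizations of finite algebras over excellent rings are excellent. -/
theorem IsExcellentRing.of_isLocalization {R D S : Type u} [CommRing R] [CommRing D] [Algebra R D]
    [Module.Finite R D] (hR : IsExcellentRing R) (N : Submonoid D) [CommRing S] [Algebra D S]
    [IsLocalization N S] : IsExcellentRing S := by
  have hRn := hR.isNoetherianRing
  have hDn : IsNoetherianRing D := IsNoetherianRing.of_finite R D
  have hloc : ∀ (B : Type u) [CommRing B] [Algebra S B], Algebra.FiniteType S B →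
      ∃ (B₀ : Type u) (_ : CommRing B₀) (_ : Algebra R B₀) (_ : Algebra B₀ B) (N' : Submonoid B₀),
        Algebra.FiniteType R B₀ ∧ IsLocalization N' B := by
    intro B _ _ hB
    let : Algebra D B := Algebra.compHom B (algebraMap D S)
    have : IsScalarTower D S B := .of_algebraMap_eq' rfl
    obtain ⟨B₀, h1, h2⟩ := IsLocalization.exists_subalgebra_finiteType (S := S) (B := B) N
    let : Algebra R B₀ := Algebra.compHom B₀ (algebraMap R D)
    have : IsScalarTower R D B₀ := .of_algebraMap_eq' rfl
    exact ⟨B₀, inferInstance, inferInstance, inferInstance, _, .trans (S := D) inferInstance h1, h2⟩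
  refine ⟨IsLocalization.isNoetherianRing N S hDn, fun B _ _ hB => ?_, fun p _ => ?_,
    fun B _ _ hB => ?_⟩
  · obtain ⟨B₀, _, _, _, N', h1, h2⟩ := hloc B hB
    exact IsCatenary.of_isLocalization N' (hR.isUniversallyCatenary B₀ h1)
  · have := IsLocalization.isLocalization_isLocalization_atPrime_isLocalization N
      (Localization.AtPrime p) p
    exact hR.isGRing.hasGeometricallyRegularFormalFibers (p.comap (algebraMap D S))
  · obtain ⟨B₀, _, _, _, N', h1, h2⟩ := hloc B hB
    exact isOpen_regularLocus_of_isLocalization N' (hR.isJ2 B₀ h1)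

/-- The formal fibres of an excellent local ring are geometrically regular. -/
theorem IsExcellentRing.hasGeometricallyRegularFormalFibers {R : Type u} [CommRing R]
    [IsLocalRing R] (hR : IsExcellentRing R) : HasGeometricallyRegularFormalFibers R := by
  have := hR.isNoetherianRing
  have : IsLocalization.AtPrime R (maximalIdeal R) :=
    IsLocalization.self fun x hx => notMem_maximalIdeal.mp hx
  exact hR.isGRing.hasGeometricallyRegularFormalFibers (D := R) (maximalIdeal R)

end LocalTheory

/-! ### Contraction to an intermediate field -/

section

variable {D L C Ω : Type*} [CommRing D] [Field L] [Algebra D L] [IsFractionRing D L]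
  [IsIntegrallyClosed D] [CommRing C] [Field Ω] [Algebra L Ω] [FiniteDimensional L Ω]
  [Algebra D Ω] [IsScalarTower D L Ω] [Algebra D C] [Algebra C Ω] [IsScalarTower D C Ω]
  [IsIntegralClosure C D Ω] (n : Ideal C) [n.IsPrime]

/-- If `Ω / L` is Galois and `x ∈ L` lies in the localization at `n` of the integral closure `C` of
`D` in `Ω`, then `x` lies in the localization of `D` at `n ∩ D`. -/
theorem IsGalois.exists_notMem_under_mul_eq [IsGalois L Ω] {x : L} {a s : C} (hs : s ∉ n)
    (hx : algebraMap L Ω x * algebraMap C Ω s = algebraMap C Ω a) :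
    ∃ b t : D, t ∉ n.under D ∧ x * algebraMap D L t = algebraMap D L b := by
  have : Algebra.IsIntegral D C := IsIntegralClosure.isIntegral_algebra D Ω
  have hCΩ : Function.Injective (algebraMap C Ω) := IsIntegralClosure.algebraMap_injective C D Ω
  -- the ideal of denominators of `x` is stable under the Galois group
  let J : Ideal C :=
    { carrier := {c | ∃ c', algebraMap L Ω x * algebraMap C Ω c = algebraMap C Ω c'}
      zero_mem' := ⟨0, by simp⟩
      add_mem' := by
        rintro c d ⟨c', hc⟩ ⟨d', hd⟩
        exact ⟨c' + d', by rw [map_add, map_add, mul_add, hc, hd]⟩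
      smul_mem' := by
        rintro c d ⟨d', hd⟩
        exact ⟨c * d', by rw [smul_eq_mul, map_mul, map_mul, ← hd]; ring⟩ }
  have hJ : ∀ t : D, algebraMap D C t ∈ J → ∃ b, x * algebraMap D L t = algebraMap D L b := by
    rintro t ⟨c', hc⟩
    have h1 : IsIntegral D (algebraMap L Ω (x * algebraMap D L t)) := by
      rw [map_mul, ← IsScalarTower.algebraMap_apply, IsScalarTower.algebraMap_apply D C Ω, hc]
      exact (Algebra.IsIntegral.isIntegral c').map (IsScalarTower.toAlgHom D C Ω)
    obtain ⟨b, hb⟩ := IsIntegrallyClosed.isIntegral_iff.mp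
      ((isIntegral_algebraMap_iff (algebraMap L Ω).injective).mp h1)
    exact ⟨b, hb.symm⟩
  by_contra! hcon
  have hJn : J.comap (algebraMap D C) ≤ n.under D := fun t ht => by
    by_contra htn
    obtain ⟨b, hb⟩ := hJ t ht
    exact hcon b t htn hb
  obtain ⟨Q, hJQ, hQ, hQn⟩ := Ideal.exists_ideal_over_prime_of_isIntegral (n.under D) J hJn
  have : IsDomain D := (IsFractionRing.injective D L).isDomain
  have : IsDomain C := hCΩ.isDomain
  have : IsFractionRing C Ω := IsIntegralClosure.isFractionRing_of_finite_extension D L Ω C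
  let := IsIntegralClosure.MulSemiringAction D L Ω C
  have : SMulCommClass Gal(Ω/L) D C := ⟨fun σ d c => map_smul (galRestrict D L Ω C σ) d c⟩
  have := Algebra.isInvariant_of_isGalois D L Ω C
  obtain ⟨σ, hσ⟩ := Algebra.IsInvariant.exists_smul_of_under_eq D C Gal(Ω/L) n Q hQn.symm
  apply hs
  rw [← Ideal.smul_mem_pointwise_smul_iff (a := σ), ← hσ]
  refine hJQ ⟨σ • a, ?_⟩
  have key : ∀ c : C, algebraMap C Ω (σ • c) = σ (algebraMap C Ω c) :=
    fun c => algebraMap_galRestrict_apply D σ c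
  rw [key, key, ← hx, map_mul, AlgEquiv.commutes]

/-- The case of a separable extension `Ω / L`, reduced to that of its normal closure. -/
theorem Algebra.IsSeparable.exists_notMem_under_mul_eq [Algebra.IsSeparable L Ω] {x : L} {a s : C}
    (hs : s ∉ n) (hx : algebraMap L Ω x * algebraMap C Ω s = algebraMap C Ω a) :
    ∃ b t : D, t ∉ n.under D ∧ x * algebraMap D L t = algebraMap D L b := by
  let Ω' := IntermediateField.normalClosure L Ω (SeparableClosure Ω)
  have : Algebra.IsSeparable L (SeparableClosure Ω) := .trans L Ω _
  have : IsSepClosure L (SeparableClosure Ω) := ⟨inferInstance, inferInstance⟩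
  have : IsGalois L Ω' := IsGalois.normalClosure _ _ _
  let : Algebra D Ω' := Algebra.compHom Ω' (algebraMap D Ω)
  have : IsScalarTower D Ω Ω' := .of_algebraMap_eq' rfl
  let : Algebra C Ω' := Algebra.compHom Ω' (algebraMap C Ω)
  have : IsScalarTower C Ω Ω' := .of_algebraMap_eq' rfl
  have : IsScalarTower D C Ω' := .of_algebraMap_eq' (by
    rw [IsScalarTower.algebraMap_eq D Ω Ω', IsScalarTower.algebraMap_eq D C Ω,
      IsScalarTower.algebraMap_eq C Ω Ω', RingHom.comp_assoc])
  have : IsScalarTower D L Ω' := .of_algebraMap_eq' (by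
    rw [IsScalarTower.algebraMap_eq D Ω Ω', IsScalarTower.algebraMap_eq D L Ω,
      IsScalarTower.algebraMap_eq L Ω Ω', RingHom.comp_assoc])
  let C' := integralClosure C Ω'
  have : Algebra.IsIntegral D C := IsIntegralClosure.isIntegral_algebra D Ω
  have hCΩ : Function.Injective (algebraMap C Ω) := IsIntegralClosure.algebraMap_injective C D Ω
  have : IsIntegralClosure C' D Ω' :=
    ⟨Subtype.val_injective, fun {x} => ⟨fun hx => ⟨⟨x, hx.tower_top⟩, rfl⟩, fun ⟨y, hy⟩ =>
      hy ▸ isIntegral_trans (A := C) _ y.2⟩⟩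
  have hCC' : Function.Injective (algebraMap C C') := by
    refine Function.Injective.of_comp (f := algebraMap C' Ω') ?_
    rw [← RingHom.coe_comp, ← IsScalarTower.algebraMap_eq, IsScalarTower.algebraMap_eq C Ω Ω']
    exact (algebraMap Ω Ω').injective.comp hCΩ
  obtain ⟨n', hn', hn⟩ := Ideal.exists_ideal_over_prime_of_isIntegral_of_isDomain (S := C') n
    (by rw [(RingHom.injective_iff_ker_eq_bot _).mp hCC']; exact bot_le)
  obtain ⟨b, t, ht, h⟩ := IsGalois.exists_notMem_under_mul_eq (D := D) (Ω := Ω') n' (x := x)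
    (a := algebraMap C C' a) (s := algebraMap C C' s) (fun h => hs (hn ▸ h)) (by
      rw [← IsScalarTower.algebraMap_apply C C', ← IsScalarTower.algebraMap_apply C C',
        IsScalarTower.algebraMap_apply C Ω, IsScalarTower.algebraMap_apply C Ω Ω', ← hx, map_mul,
        ← IsScalarTower.algebraMap_apply L])
  refine ⟨b, t, fun htn => ht ?_, h⟩
  rw [← hn] at htn
  change algebraMap D C' t ∈ n'
  rw [IsScalarTower.algebraMap_apply D C C']
  exact htn

end

/-! ### Domains integral over a complete local ring -/

namespace LocalTheory

section

variable {R : Type u} [CommRing R] [IsLocalRing R] [IsNoetherianRing R]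

/-- A finite free algebra over `R̂` is complete. -/
theorem isAdicComplete_of_basis {E : Type*} [CommRing E] [Algebra R E]
    [Algebra (Completion R) E] [IsScalarTower R (Completion R) E] {k : ℕ}
    (b : Module.Basis (Fin k) (Completion R) E) :
    IsAdicComplete ((maximalIdeal R).map (algebraMap R E)) E := by
  rw [IsAdicComplete.map_algebraMap_iff]
  have : IsAdicComplete (maximalIdeal R) (AdicCompletion (maximalIdeal R) (Fin k → R)) :=
    AdicCompletion.isAdicComplete (maximalIdeal R).fg_of_isNoetherianRing
  exact IsAdicComplete.of_linearEquiv _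
    (((AdicCompletion.piEquivFin (maximalIdeal R) k).trans b.equivFun.symm).restrictScalars R)

/-- A domain that is integral over a complete local ring is local.

An element `b` of one maximal ideal but not of another one would define a finite free algebra
`R̂[X] / (f)`, with `f b = 0`, in which the two maximal ideals are separated by an idempotent; it
maps to `0` or `1` in the domain. -/
theorem isLocalRing_of_isIntegral_completion (B : Type*) [CommRing B] [IsDomain B]
    [Algebra (Completion R) B] [Algebra.IsIntegral (Completion R) B] : IsLocalRing B := by
  refine .of_unique_max_ideal ?_
  obtain ⟨P, hP⟩ := Ideal.exists_maximal B
  refine ⟨P, hP, fun P' hP' => (hP'.eq_of_le hP.ne_top fun b hb => ?_)⟩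
  obtain ⟨f, hf, hfb⟩ := Algebra.IsIntegral.isIntegral (R := Completion R) b
  let E := AdjoinRoot f
  let pb := AdjoinRoot.powerBasis' hf
  have hfin : Module.Finite (Completion R) E := pb.finite
  let I := (maximalIdeal R).map (algebraMap R E)
  have hI : (maximalIdeal (Completion R)).map (algebraMap (Completion R) E) = I := by
    rw [AdicCompletion.maximalIdeal_eq_map, Ideal.map_map, ← IsScalarTower.algebraMap_eq]
  have : IsAdicComplete I E := isAdicComplete_of_basis pb.basis
  let g : E →ₐ[Completion R] B := AdjoinRoot.liftAlgHom f (Algebra.ofId _ _) b hfb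
  have hg : g (AdjoinRoot.root f) = b := AdjoinRoot.liftAlgHom_root ..
  let := g.toRingHom.toAlgebra
  have : IsScalarTower (Completion R) E B := .of_algebraMap_eq' g.comp_algebraMap.symm
  have : Algebra.IsIntegral E B := .tower_top (Completion R)
  let Q := P.comap (algebraMap E B)
  let Q' := P'.comap (algebraMap E B)
  have hQ : Q.IsMaximal := Ideal.isMaximal_comap_of_isIntegral_of_isMaximal P
  have hQ' : Q'.IsMaximal := Ideal.isMaximal_comap_of_isIntegral_of_isMaximal P'
  obtain ⟨d, hdQ, hdd, k, hk, hkd⟩ := exists_mem_idempotent_mod (R := Completion R) Q'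
  rw [hI] at hdd hkd
  obtain ⟨e, he, hed⟩ := HenselianRing.exists_isIdempotentElem_sub_mem I hdd
  have hIQ : I ≤ Q := hI ▸ map_maximalIdeal_le Q
  have hIQ' : I ≤ Q' := hI ▸ map_maximalIdeal_le Q'
  -- the idempotent `e` maps to `0` in the domain `B`, since it lies in `Q'`
  have heQ' : e ∈ Q' := by simpa using Ideal.add_mem _ (hIQ' hed) hdQ
  have hge : algebraMap E B e = 0 := by
    refine (IsIdempotentElem.iff_eq_zero_or_one.mp (he.map (algebraMap E B))).resolve_right ?_
    intro h1
    exact (Ideal.ne_top_iff_one _).mp hP'.ne_top (h1 ▸ heQ')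
  have heQ : e ∈ Q := by
    change algebraMap E B e ∈ P
    rw [hge]
    exact P.zero_mem
  have hdQ : d ∈ Q := by simpa using Ideal.sub_mem _ heQ (hIQ hed)
  have hle : Q' ≤ Q := (Ideal.IsPrime.pow_le_iff hk).mp
    (hkd.trans (sup_le ((Ideal.span_singleton_le_iff_mem _).mpr hdQ) hIQ))
  have := hle (show AdjoinRoot.root f ∈ Q' from by
    change g (AdjoinRoot.root f) ∈ P'
    rwa [hg])
  change g (AdjoinRoot.root f) ∈ P at this
  rwa [hg] at this

end

end LocalTheory

/-! ### Maps between completions -/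

namespace LocalTheory

theorem evalₐ_completionMap {A B : Type*} [CommRing A] [CommRing B] [IsLocalRing A] [IsLocalRing B]
    (f : A →+* B) [IsLocalHom f] (k : ℕ) (x : Completion A) :
    AdicCompletion.evalₐ (maximalIdeal B) k (completionMap f x) =
      Ideal.quotientMap (maximalIdeal B ^ k) f (pow_le_comap f k)
        (AdicCompletion.evalₐ (maximalIdeal A) k x) :=
  AdicCompletion.evalₐ_liftRingHom _ _ (completionMap_compatible f) k x

theorem completionMap_comp {A B C : Type*} [CommRing A] [CommRing B] [CommRing C] [IsLocalRing A]
    [IsLocalRing B] [IsLocalRing C] (f : A →+* B) (g : B →+* C) [IsLocalHom f] [IsLocalHom g]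
    (h : A →+* C) [IsLocalHom h] (hh : g.comp f = h) (x : Completion A) :
    completionMap g (completionMap f x) = completionMap h x := by
  subst hh
  apply AdicCompletion.ext_evalₐ
  intro k
  rw [evalₐ_completionMap, evalₐ_completionMap, evalₐ_completionMap, ← RingHom.comp_apply]
  congr 1
  ext a
  rfl

section

variable {R : Type u} [CommRing R] [IsLocalRing R] [IsNoetherianRing R]
  {D : Type u} [CommRing D] [Algebra R D] [Module.Finite R D]
  {A : Type u} [CommRing A] [IsLocalRing A] [Algebra D A] [Algebra R A]
  [IsScalarTower R D A] [IsLocalHom (algebraMap R A)]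

/-- If the finite algebra `D` embeds into a flat `R`-algebra and `R̂` is a domain, then
`D ⊗ R̂` is torsion-free over `R̂`; hence `R̂` embeds into each direct factor of this ring. -/
theorem injective_completionMap_algebraMap (n : Ideal D) [n.IsMaximal]
    [IsLocalization.AtPrime A n] [IsDomain (Completion R)] (Ω : Type u) [CommRing Ω]
    [Algebra R Ω] [Algebra D Ω] [IsScalarTower R D Ω] [Module.Flat R Ω]
    (hΩ : Function.Injective (algebraMap D Ω)) :
    Function.Injective (completionMap (algebraMap R A)) := by
  have : IsNoetherianRing D := IsNoetherianRing.of_finite R D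
  have : IsNoetherianRing A := IsLocalization.isNoetherianRing n.primeCompl A inferInstance
  rw [injective_iff_map_eq_zero]
  intro x hx
  obtain ⟨-, e, he, hker⟩ := tensorCompletionMap_surjective_and_ker (A := A) (R := R) n
  have hflat : Module.Flat R (Completion R) := AdicCompletion.flat_of_isNoetherian _
  let ψ : D ⊗[R] Completion R →ₐ[R] Ω ⊗[R] Completion R :=
    Algebra.TensorProduct.map (IsScalarTower.toAlgHom R D Ω) (AlgHom.id R _)
  have hψ : Function.Injective ψ :=
    Module.Flat.rTensor_preserves_injective_linearMap (M := Completion R)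
      (IsScalarTower.toAlgHom R D Ω).toLinearMap hΩ
  let ψ' : D ⊗[R] Completion R →ₐ[R] Completion R ⊗[R] Ω :=
    (Algebra.TensorProduct.comm R Ω (Completion R)).toAlgHom.comp ψ
  have hψ' : Function.Injective ψ' :=
    (Algebra.TensorProduct.comm R Ω (Completion R)).injective.comp hψ
  have h1 : (1 ⊗ₜ x : D ⊗[R] Completion R) ∈ RingHom.ker (tensorCompletionMap R D A) := by
    rw [RingHom.mem_ker, tensorCompletionMap_tmul, hx, mul_zero]
  rw [hker] at h1
  obtain ⟨c, hc⟩ := Ideal.mem_span_singleton'.mp h1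
  have h2 : (1 ⊗ₜ x : D ⊗[R] Completion R) * (1 - e) = 0 := by
    rw [← hc]
    linear_combination -c * he.eq
  have h3 : algebraMap (Completion R) (Completion R ⊗[R] Ω) x * ψ' (1 - e) = 0 := by
    have h4 := congrArg ψ' h2
    rw [map_mul, map_zero] at h4
    rw [← h4]
    congr 1
    simp [ψ', ψ]
  have htf : Module.IsTorsionFree (Completion R) (Completion R ⊗[R] Ω) := inferInstance
  refine (smul_eq_zero.mp ((Algebra.smul_def x _).trans h3)).resolve_right fun h4 => ?_
  have h5 : 1 - e = 0 := hψ' (h4.trans (map_zero ψ').symm)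
  have h6 : tensorCompletionMap R D A e = 0 := by
    rw [← RingHom.mem_ker, hker]
    exact Ideal.mem_span_singleton_self e
  rw [← sub_eq_zero.mp h5, map_one] at h6
  exact one_ne_zero h6

theorem isIntegral_completionMap_algebraMap (n : Ideal D) [n.IsMaximal]
    [IsLocalization.AtPrime A n] : (completionMap (algebraMap R A)).IsIntegral := by
  let := (completionMap (algebraMap R A)).toAlgebra
  have : IsScalarTower R (Completion R) (Completion A) := .of_algebraMap_eq fun r => by
    rw [IsScalarTower.algebraMap_apply R A (Completion A)]
    exact (completionMap_algebraMap (algebraMap R A) r).symm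
  intro y
  obtain ⟨z, rfl⟩ := (tensorCompletionMap_surjective_and_ker (A := A) (R := R) n).1 y
  change IsIntegral (Completion R) _
  induction z with
  | zero => rw [map_zero]; exact isIntegral_zero
  | add z w hz hw => rw [map_add]; exact hz.add hw
  | tmul d y =>
    rw [tensorCompletionMap_tmul]
    refine IsIntegral.mul ?_ (isIntegral_algebraMap (A := Completion A) (x := y))
    exact ((Algebra.IsIntegral.isIntegral (R := R) d).map
      (IsScalarTower.toAlgHom R D (Completion A))).tower_top

/-- The quotient field of `Â` is generated by `R̂` and `D`. -/
theorem subfield_eq_top_of_mem (n : Ideal D) [n.IsMaximal]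
    [IsLocalization.AtPrime A n] [IsDomain (Completion A)]
    (E : Subfield (FractionRing (Completion A)))
    (hR : ∀ y : Completion R, algebraMap _ (FractionRing (Completion A))
      (completionMap (algebraMap R A) y) ∈ E)
    (hD : ∀ d : D, algebraMap _ (FractionRing (Completion A))
      (algebraMap A (Completion A) (algebraMap D A d)) ∈ E) : E = ⊤ := by
  have h : ∀ x : Completion A, algebraMap _ (FractionRing (Completion A)) x ∈ E := by
    intro x
    obtain ⟨z, rfl⟩ := (tensorCompletionMap_surjective_and_ker (A := A) (R := R) n).1 x
    induction z with
    | zero => rw [map_zero, map_zero]; exact E.zero_mem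
    | add z w hz hw => rw [map_add, map_add]; exact E.add_mem hz hw
    | tmul d y =>
      rw [tensorCompletionMap_tmul, map_mul, IsScalarTower.algebraMap_apply D A (Completion A)]
      exact E.mul_mem (hD d) (hR y)
  rw [eq_top_iff]
  intro x _
  obtain ⟨a, b, -, rfl⟩ := IsFractionRing.div_surjective (A := Completion A) x
  exact E.div_mem (h a) (h b)

end

/-- A domain integral over `R̂` embeds into `Â` if `R̂` does: the kernel meets `R̂` in zero. -/
theorem injective_completionMap_of_comp {R S A : Type*} [CommRing R] [CommRing S] [CommRing A]
    [IsLocalRing R] [IsLocalRing S] [IsLocalRing A] (f : R →+* S) (g : S →+* A) (h : R →+* A)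
    [IsLocalHom f] [IsLocalHom g] [IsLocalHom h] (hh : g.comp f = h) [IsDomain (Completion S)]
    [Nontrivial (Completion R)]
    (hf : (completionMap f).IsIntegral) (hinj : Function.Injective (completionMap h)) :
    Function.Injective (completionMap g) := by
  let := (completionMap f).toAlgebra
  have : Algebra.IsIntegral (Completion R) (Completion S) := ⟨hf⟩
  rw [RingHom.injective_iff_ker_eq_bot]
  refine Ideal.eq_bot_of_comap_eq_bot (R := Completion R) ?_
  rw [eq_bot_iff]
  intro x hx
  refine (injective_iff_map_eq_zero _).mp hinj x ?_
  rw [← completionMap_comp f g h hh]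
  exact hx

theorem injective_algebraMap_completion (A : Type*) [CommRing A] [IsLocalRing A]
    [IsNoetherianRing A] : Function.Injective (algebraMap A (Completion A)) :=
  AdicCompletion.of_injective_iff.mpr
    (.of_le_jacobson _ _ (maximalIdeal_le_jacobson _))

/-! ### The trivial extension is unramified -/

theorem IsUnramifiedAtPrime.of_bijective {B C : Type*} [CommRing B] [CommRing C] [Algebra B C]
    (h : Function.Bijective (algebraMap B C)) (Q : Ideal C) [Q.IsPrime] :
    IsUnramifiedAtPrime B Q := by
  have hs : Function.Surjective
      (Ideal.ResidueField.map (Q.under B) Q (algebraMap B C) rfl) :=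
    ((RingHom.surjectiveOnStalks_of_surjective h.2).residueFieldMap_bijective _ Q rfl).2
  refine ⟨?_, .of_surjective _ hs, ?_⟩
  · rw [IsScalarTower.algebraMap_eq B C, ← Ideal.map_map,
      Ideal.map_comap_of_surjective _ h.2, IsLocalization.AtPrime.map_eq_maximalIdeal]
  · let := (Ideal.ResidueField.map (Q.under B) Q (algebraMap B C) rfl).toAlgebra
    refine ⟨fun x => ?_⟩
    obtain ⟨y, rfl⟩ := hs x
    exact isSeparable_algebraMap y

/-- For `E = F` the integral closure of `O` in `E` coincides with its own integral closure in
`F`. -/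
theorem IsUnramifiedExtension.top {F : Type*} [Field F] (O : Subring F)
    (hloc : IsLocalRing (integralClosureIn O ⊤)) : IsUnramifiedExtension O (⊤ : Subfield F) := by
  have hs : Function.Surjective (algebraMap (⊤ : Subfield F) F) := fun x => ⟨⟨x, trivial⟩, rfl⟩
  refine ⟨Module.Finite.of_surjective (Algebra.linearMap _ _) hs, ⟨fun x => ?_⟩, hloc,
    fun Q _ => .of_bijective ⟨?_, ?_⟩ Q⟩
  · obtain ⟨y, rfl⟩ := hs x
    exact isSeparable_algebraMap y
  · intro x y hxy
    exact Subtype.ext (congrArg (fun z : integralClosure (integralClosureIn O ⊤) F => (z : F)) hxy)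
  · intro x
    have hle : O ≤ integralClosureIn O ⊤ := fun y hy =>
      ⟨isIntegral_algebraMap (R := O) (x := (⟨y, hy⟩ : O)), trivial⟩
    let := (Subring.inclusion hle).toAlgebra
    have : IsScalarTower O (integralClosureIn O ⊤) F := .of_algebraMap_eq' rfl
    have : Algebra.IsIntegral O (integralClosureIn O ⊤) := ⟨fun y =>
      (isIntegral_algebraMap_iff (B := F) Subtype.val_injective).mp y.2.1⟩
    exact ⟨⟨x, isIntegral_trans (R := O) _ x.2, trivial⟩, rfl⟩

theorem isLocalRing_integralClosureIn_range {R : Type u} [CommRing R] [IsLocalRing R]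
    [IsNoetherianRing R] {F : Type*} [Field F] (φ : Completion R →+* F) :
    IsLocalRing (integralClosureIn φ.range (⊤ : Subfield F)) := by
  let := φ.toAlgebra
  let := φ.rangeRestrict.toAlgebra
  have : IsScalarTower (Completion R) φ.range F := .of_algebraMap_eq' rfl
  have hint : Algebra.IsIntegral (Completion R) φ.range := ⟨fun x => by
    obtain ⟨y, rfl⟩ := φ.rangeRestrict_surjective x
    exact isIntegral_algebraMap (R := Completion R) (A := φ.range)⟩
  have hmem : ∀ y, φ y ∈ integralClosureIn φ.range ⊤ := fun y =>
    ⟨isIntegral_algebraMap (R := φ.range) (x := φ.rangeRestrict y), trivial⟩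
  let := (φ.codRestrict (integralClosureIn φ.range ⊤) hmem).toAlgebra
  have : IsScalarTower (Completion R) (integralClosureIn φ.range ⊤) F := .of_algebraMap_eq' rfl
  have : Algebra.IsIntegral (Completion R) (integralClosureIn φ.range ⊤) := ⟨fun x =>
    (isIntegral_algebraMap_iff (B := F) Subtype.val_injective).mp
      (isIntegral_trans (A := φ.range) _ x.2.1)⟩
  exact isLocalRing_of_isIntegral_completion (R := R) _

end LocalTheory

/-! ### The local rings `A ∩ L` -/

/-- A subring of a field is a localization of `D` at `p` if it consists of the fractions with
denominator outside `p`. -/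
theorem Subring.isLocalization_atPrime {D Ω : Type*} [CommRing D] [Field Ω] [Algebra D Ω]
    (hinj : Function.Injective (algebraMap D Ω)) (A : Subring Ω) [Algebra D A]
    [IsScalarTower D A Ω] (p : Ideal D) [p.IsPrime]
    (h : ∀ x : Ω, x ∈ A ↔ ∃ a s : D, s ∉ p ∧ x = algebraMap D Ω a / algebraMap D Ω s) :
    IsLocalization.AtPrime A p := by
  have hA : ∀ d : D, ((algebraMap D A d : A) : Ω) = algebraMap D Ω d :=
    fun d => (IsScalarTower.algebraMap_apply D A Ω d).symm
  have h0 : ∀ s : D, s ∉ p → algebraMap D Ω s ≠ 0 := fun s hs h =>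
    hs ((injective_iff_map_eq_zero _).mp hinj s h ▸ p.zero_mem)
  refine ⟨?_, fun x => ?_, fun {x y} hxy => ⟨1, ?_⟩⟩
  · rintro ⟨s, hs⟩
    refine IsUnit.of_mul_eq_one ⟨(algebraMap D Ω s)⁻¹, (h _).mpr ⟨1, s, hs, by simp⟩⟩ ?_
    apply Subtype.ext
    change ((algebraMap D A s : A) : Ω) * _ = 1
    rw [hA]
    exact mul_inv_cancel₀ (h0 s hs)
  · obtain ⟨a, s, hs, hx⟩ := (h x).mp x.2
    refine ⟨(a, ⟨s, hs⟩), ?_⟩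
    apply Subtype.ext
    change (x : Ω) * ((algebraMap D A s : A) : Ω) = ((algebraMap D A a : A) : Ω)
    rw [hA, hA, hx, div_mul_cancel₀ _ (h0 s hs)]
  · have := congrArg (Subtype.val : A → Ω) hxy
    rw [hA, hA] at this
    rw [hinj this]

namespace LocalTheory

section

variable {R Ω : Type*} [CommRing R] [Field Ω] [Algebra R Ω] (n : Ideal (integralClosure R Ω))
  [n.IsPrime]

/-- The canonical homomorphism from the integral closure of `R` in `Ω` to `A`. -/
noncomputable def integralClosureToLocalRingAt :
    integralClosure R Ω →+* (localRingAt R n).toSubring :=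
  (algebraMap (integralClosure R Ω) Ω).codRestrict _ fun d => le_localRingAt n d

theorem isLocalization_localRingAt :
    letI := (integralClosureToLocalRingAt n).toAlgebra
    IsLocalization.AtPrime (localRingAt R n).toSubring n := by
  let := (integralClosureToLocalRingAt n).toAlgebra
  have : IsScalarTower (integralClosure R Ω) (localRingAt R n).toSubring Ω :=
    .of_algebraMap_eq' rfl
  exact Subring.isLocalization_atPrime Subtype.val_injective _ _ fun x => mem_localRingAt n

end

section

variable {R K Ω : Type u} [CommRing R] [IsDomain R]
  [Field K] [Algebra R K] [IsFractionRing R K] [Field Ω] [Algebra K Ω]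
  [Algebra R Ω] [IsScalarTower R K Ω] [FiniteDimensional K Ω] [Algebra.IsSeparable K Ω]
  (L : IntermediateField K Ω) (n : Ideal (integralClosure R Ω)) [n.IsPrime]

/-- The inclusion of the integral closure of `R` in `L` into its integral closure in `Ω`. -/
noncomputable def integralClosureInclusion : integralClosure R L →ₐ[R] integralClosure R Ω :=
  (L.val.restrictScalars R).mapIntegralClosure

/-- `A ∩ L` consists of fractions of elements of the integral closure of `R` in `L`. -/
theorem mem_localRingAt_coe_iff (x : L) : (x : Ω) ∈ (localRingAt R n).toSubring ↔
    ∃ a s : integralClosure R L, s ∉ n.comap (integralClosureInclusion L) ∧ (x : L) = a / s := by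
  constructor
  · intro hx
    obtain ⟨a, s, hs, hxas⟩ := (mem_localRingAt n).mp hx
    have hs0 : (s : Ω) ≠ 0 := fun h => hs ((Subtype.ext h : s = 0) ▸ n.zero_mem)
    let := (integralClosureInclusion (R := R) L).toRingHom.toAlgebra
    have : IsScalarTower (integralClosure R L) (integralClosure R Ω) Ω := .of_algebraMap_eq' rfl
    have : IsScalarTower R (integralClosure R L) (integralClosure R Ω) := .of_algebraMap_eq' rfl
    have : IsFractionRing (integralClosure R L) L :=
      integralClosure.isFractionRing_of_finite_extension K L
    have : IsIntegrallyClosed (integralClosure R L) :=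
      integralClosure.isIntegrallyClosedOfFiniteExtension K
    have : IsScalarTower R (integralClosure R L) Ω := .of_algebraMap_eq' rfl
    have : IsIntegralClosure (integralClosure R Ω) (integralClosure R L) Ω :=
      IsIntegralClosure.tower_top (R := R)
    obtain ⟨b, t, ht, h⟩ := Algebra.IsSeparable.exists_notMem_under_mul_eq
      (D := integralClosure R L) (L := L) n (x := x) (a := a) (s := s) hs (by
        change (x : Ω) * (s : Ω) = a
        rw [hxas, div_mul_cancel₀ _ hs0])
    refine ⟨b, t, ht, ?_⟩
    have ht0 : (t : L) ≠ 0 := fun h => ht ((Subtype.ext h : t = 0) ▸ Ideal.zero_mem _)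
    rw [eq_div_iff ht0]
    exact h
  · rintro ⟨a, s, hs, rfl⟩
    refine (mem_localRingAt n).mpr ⟨integralClosureInclusion L a, integralClosureInclusion L s, hs,
      rfl⟩

variable (R) in
/-- The canonical homomorphism from the integral closure of `R` in `L` to `A ∩ L`. -/
noncomputable def toInterSubfield :
    integralClosure R L →+* (interSubfield (localRingAt R n) L.toSubfield).toSubring :=
  ((algebraMap L Ω).comp (algebraMap (integralClosure R L) L)).codRestrict _ fun d =>
    ⟨le_localRingAt n (integralClosureInclusion L d), (d : L).2⟩

instance isPrime_comap_integralClosureInclusion :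
    (n.comap (integralClosureInclusion (R := R) L)).IsPrime := Ideal.comap_isPrime _ _

theorem isLocalization_interSubfield :
    letI := (toInterSubfield R L n).toAlgebra
    IsLocalization.AtPrime (interSubfield (localRingAt R n) L.toSubfield).toSubring
      (n.comap (integralClosureInclusion (R := R) L)) := by
  let := (toInterSubfield R L n).toAlgebra
  have : IsScalarTower (integralClosure R L)
    (interSubfield (localRingAt R n) L.toSubfield).toSubring Ω := .of_algebraMap_eq' rfl
  refine Subring.isLocalization_atPrime
    (fun _ _ h => Subtype.ext ((algebraMap L Ω).injective h)) _ _ fun x => ?_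
  constructor
  · rintro ⟨hx, hxL⟩
    obtain ⟨a, s, hs, h⟩ := (mem_localRingAt_coe_iff L n ⟨x, hxL⟩).mp hx
    exact ⟨a, s, hs, congrArg (algebraMap L Ω) h⟩
  · rintro ⟨a, s, hs, rfl⟩
    exact ⟨(mem_localRingAt_coe_iff L n (a / s)).mpr ⟨a, s, hs, rfl⟩, ((a : L) / (s : L)).2⟩

end

end LocalTheory

/-! ### The quotient fields of the completions -/

namespace LocalTheory

theorem isMaximal_comap_integralClosureInclusion {R K Ω : Type u} [CommRing R]
    [Field K] [Algebra R K] [Field Ω] [Algebra K Ω] [Algebra R Ω] [IsScalarTower R K Ω]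
    (L : IntermediateField K Ω) (n : Ideal (integralClosure R Ω)) [n.IsMaximal] :
    (n.comap (integralClosureInclusion (R := R) L)).IsMaximal := by
  exact Ideal.isMaximal_of_isIntegral_of_isMaximal_comap (R := R) _
    (Ideal.isMaximal_comap_of_isIntegral_of_isMaximal (R := R) n)

section

variable {R K Ω : Type u} [CommRing R] [IsDomain R] [Field K] [Algebra R K] [IsFractionRing R K]
  [Field Ω] [Algebra K Ω] [Algebra R Ω] [IsScalarTower R K Ω] [FiniteDimensional K Ω]
  (L : IntermediateField K Ω) (n : Ideal (integralClosure R Ω)) [n.IsMaximal]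

/-- Every element of `L` is a fraction of elements of `A ∩ L`. -/
theorem exists_div_interSubfield (l : L) :
    ∃ a b : (interSubfield (localRingAt R n) L.toSubfield).toSubring, (l : Ω) = a / b := by
  have : IsFractionRing (integralClosure R L) L :=
    integralClosure.isFractionRing_of_finite_extension K L
  obtain ⟨a, b, -, h⟩ := IsFractionRing.div_surjective (A := integralClosure R L) l
  exact ⟨toInterSubfield R L n a, toInterSubfield R L n b, congrArg (algebraMap L Ω) h.symm⟩

/-- A subfield of the quotient field of `Â` that contains the images of `A ∩ L` and `A ∩ M`
contains the image of `A`. -/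
theorem mem_subfield_of_sup_eq_top {F : Type*} [Field F] (f : (localRingAt R n).toSubring →+* F)
    (hf : Function.Injective f) (M : IntermediateField K Ω) (hΩ : L ⊔ M = ⊤) (E : Subfield F)
    (hL : ∀ a, f (inclusion (localRingAt R n) L.toSubfield a) ∈ E)
    (hM : ∀ a, f (inclusion (localRingAt R n) M.toSubfield a) ∈ E)
    (a : (localRingAt R n).toSubring) : f a ∈ E := by
  have : IsFractionRing (integralClosure R Ω) Ω :=
    integralClosure.isFractionRing_of_finite_extension K Ω
  have : IsFractionRing (localRingAt R n).toSubring Ω := by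
    let := (integralClosureToLocalRingAt n).toAlgebra
    have : IsScalarTower (integralClosure R Ω) (localRingAt R n).toSubring Ω :=
      .of_algebraMap_eq' rfl
    have : IsLocalization.AtPrime (localRingAt R n).toSubring n := isLocalization_localRingAt n
    exact IsFractionRing.isFractionRing_of_isDomain_of_isLocalization n.primeCompl _ _
  let ψ : Ω →+* F := IsFractionRing.lift hf
  have hψ : ∀ a : (localRingAt R n).toSubring, ψ (a : Ω) = f a :=
    fun a => IsFractionRing.lift_algebraMap hf a
  have key : ∀ N : IntermediateField K Ω,
      (∀ a, f (inclusion (localRingAt R n) N.toSubfield a) ∈ E) → ∀ l ∈ N, ψ l ∈ E := by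
    intro N hN l hl
    obtain ⟨a, b, h⟩ := exists_div_interSubfield N n ⟨l, hl⟩
    change l = _ at h
    rw [h, map_div₀]
    exact E.div_mem (hψ (inclusion _ _ a) ▸ hN a) (hψ (inclusion _ _ b) ▸ hN b)
  let E' : IntermediateField K Ω :=
    { E.comap ψ with algebraMap_mem' := fun k => key L hL _ (L.algebraMap_mem k) }
  have h : L ⊔ M ≤ E' := sup_le (fun l hl => key L hL l hl) fun l hl => key M hM l hl
  rw [← hψ]
  rw [hΩ] at h
  exact h (IntermediateField.mem_top (x := (a : Ω)))

end

section

variable {R K Ω : Type u} [CommRing R] [IsDomain R] [IsLocalRing R]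
  [Field K] [Algebra R K] [IsFractionRing R K] [Field Ω] [Algebra K Ω]
  [Algebra R Ω] [IsScalarTower R K Ω] [FiniteDimensional K Ω]
  (L : IntermediateField K Ω) (n : Ideal (integralClosure R Ω)) [n.IsMaximal]

/-- Normality and excellence of `A ∩ L`, its completion, and the maps between the completions of
`R`, `A ∩ L` and `A`. -/
theorem interSubfield_properties [IsIntegrallyClosed R] [Algebra.IsSeparable K Ω]
    (hR : IsExcellentRing R) [IsDomain (Completion R)]
    (hinj : Function.Injective (completionMap (toLocalRingAt n))) :
    IsIntegrallyClosed (interSubfield (localRingAt R n) L.toSubfield).toSubring ∧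
    IsExcellentRing (interSubfield (localRingAt R n) L.toSubfield).toSubring ∧
    IsDomain (Completion (interSubfield (localRingAt R n) L.toSubfield).toSubring) ∧
    Function.Injective (completionMap (inclusion (localRingAt R n) L.toSubfield)) ∧
    ∀ y : Completion R, ∃ z, completionMap (inclusion (localRingAt R n) L.toSubfield) z =
      completionMap (toLocalRingAt n) y := by
  have := hR.isNoetherianRing
  let S := (interSubfield (localRingAt R n) L.toSubfield).toSubring
  let D := integralClosure R L
  let p : Ideal D := n.comap (integralClosureInclusion (R := R) L)
  let := (toInterSubfield R L n).toAlgebra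
  have : IsLocalization.AtPrime S p := isLocalization_interSubfield L n
  have : p.IsMaximal := isMaximal_comap_integralClosureInclusion L n
  have : Module.Finite R D := IsIntegralClosure.finite R K L D
  have : IsIntegrallyClosed D := integralClosure.isIntegrallyClosedOfFiniteExtension K
  have : IsIntegrallyClosed S := isIntegrallyClosed_of_isLocalization S p.primeCompl
    p.primeCompl_le_nonZeroDivisors
  have hS : IsExcellentRing S := hR.of_isLocalization (D := D) p.primeCompl
  have := hS.isNoetherianRing
  have hdS : IsDomain (Completion S) := isDomain_completion hS.hasGeometricallyRegularFormalFibers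
  let : Algebra R S := ((toInterSubfield R L n).comp (algebraMap R D)).toAlgebra
  have : IsScalarTower R D S := .of_algebraMap_eq' rfl
  have : IsLocalHom (algebraMap R S) := isLocalHom_algebraMap_of_finite p
  have hcomp : (inclusion (localRingAt R n) L.toSubfield).comp (algebraMap R S) =
    toLocalRingAt n := rfl
  refine ⟨inferInstance, hS, hdS, ?_, fun y => ⟨completionMap (algebraMap R S) y,
    completionMap_comp _ _ _ hcomp y⟩⟩
  exact injective_completionMap_of_comp _ _ _ hcomp (isIntegral_completionMap_algebraMap p) hinj

end

end LocalTheory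

theorem lemma2p8 {R K Ω : Type u} [CommRing R] [IsDomain R] [IsLocalRing R] [IsIntegrallyClosed R]
    (hR : IsExcellentRing R) [Field K] [Algebra R K] [IsFractionRing R K] [Field Ω] [Algebra K Ω]
    [Algebra R Ω] [IsScalarTower R K Ω] (L M : IntermediateField K Ω) [FiniteDimensional K L]
    [Algebra.IsSeparable K L] [FiniteDimensional K M] [Algebra.IsSeparable K M] (hΩ : L ⊔ M = ⊤)
    (n : Ideal (integralClosure R Ω)) [n.IsMaximal] :
    let A : LocalSubring Ω := localRingAt R n
    let S : LocalSubring Ω := interSubfield A L.toSubfield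
    let T : LocalSubring Ω := interSubfield A M.toSubfield
    let r : R →+* A.toSubring := toLocalRingAt n
    let i : S.toSubring →+* A.toSubring := inclusion A L.toSubfield
    let j : T.toSubring →+* A.toSubring := inclusion A M.toSubfield
    (IsLocalRing S.toSubring ∧ IsDomain S.toSubring ∧ IsIntegrallyClosed S.toSubring ∧
      IsExcellentRing S.toSubring) ∧
    (IsLocalRing T.toSubring ∧ IsDomain T.toSubring ∧ IsIntegrallyClosed T.toSubring ∧
      IsExcellentRing T.toSubring) ∧
    ∃ (_ : IsDomain (Completion R)) (_ : IsDomain (Completion S.toSubring))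
      (_ : IsDomain (Completion T.toSubring)) (_ : IsDomain (Completion A.toSubring))
      (_ : Function.Injective (completionMap r)) (hi : Function.Injective (completionMap i))
      (hj : Function.Injective (completionMap j)),
      ((ResidueField.map i).fieldRange ⊔ (ResidueField.map j).fieldRange = ⊤ →
        quotientSubfield hi ⊔ quotientSubfield hj = ⊤) ∧
      (IsSeparableHom (ResidueField.map i) →
        IsUnramifiedExtension
          ((algebraMap (Completion A.toSubring) (FractionRing (Completion A.toSubring))).comp
            (completionMap r)).range
          (quotientSubfield hi ⊔ quotientSubfield hj)) := by
  intro A S T r i j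
  have hRn := hR.isNoetherianRing
  have hfin : FiniteDimensional K Ω := by
    have : FiniteDimensional K (⊤ : IntermediateField K Ω) := hΩ ▸ inferInstance
    exact .equiv (IntermediateField.topEquiv (F := K) (E := Ω)).toLinearEquiv
  have hsep : Algebra.IsSeparable K Ω := by
    have : Algebra.IsSeparable K (⊤ : IntermediateField K Ω) :=
      hΩ ▸ (inferInstance : Algebra.IsSeparable K (L ⊔ M : IntermediateField K Ω))
    exact .of_algHom _ _ (IntermediateField.topEquiv (F := K) (E := Ω)).symm.toAlgHom
  let D := integralClosure R Ω
  let := (integralClosureToLocalRingAt n).toAlgebra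
  have : IsLocalization.AtPrime A.toSubring n := isLocalization_localRingAt n
  have : Module.Finite R D := IsIntegralClosure.finite R K Ω D
  have : IsIntegrallyClosed D := integralClosure.isIntegrallyClosedOfFiniteExtension K
  have : IsIntegrallyClosed A.toSubring := isIntegrallyClosed_of_isLocalization A.toSubring
    n.primeCompl n.primeCompl_le_nonZeroDivisors
  have hA : IsExcellentRing A.toSubring := hR.of_isLocalization (D := D) n.primeCompl
  have := hA.isNoetherianRing
  have hdA : IsDomain (Completion A.toSubring) :=
    isDomain_completion hA.hasGeometricallyRegularFormalFibers
  have hdR : IsDomain (Completion R) := isDomain_completion hR.hasGeometricallyRegularFormalFibers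
  let : Algebra R A.toSubring := r.toAlgebra
  have : IsScalarTower R D A.toSubring := .of_algebraMap_eq' rfl
  have : IsLocalHom (algebraMap R A.toSubring) := inferInstanceAs (IsLocalHom (toLocalRingAt n))
  have hflat : Module.Flat R Ω := by
    have : Module.Flat R K := IsLocalization.flat K (nonZeroDivisors R)
    exact Module.Flat.trans R K Ω
  have hr : Function.Injective (completionMap r) :=
    injective_completionMap_algebraMap n Ω Subtype.val_injective
  obtain ⟨hS1, hS2, hS3, hi, hS4⟩ := interSubfield_properties L n hR hr
  obtain ⟨hT1, hT2, hT3, hj, -⟩ := interSubfield_properties M n hR hr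
  refine ⟨⟨S.isLocalRing, inferInstance, hS1, hS2⟩, ⟨T.isLocalRing, inferInstance, hT1, hT2⟩,
    hdR, hS3, hT3, hdA, hr, hi, hj, ?_⟩
  have hmi : ∀ z, algebraMap _ (FractionRing (Completion A.toSubring)) (completionMap i z) ∈
      quotientSubfield hi ⊔ quotientSubfield hj := fun z =>
    (le_sup_left : quotientSubfield hi ≤ _) ⟨algebraMap _ _ z, IsLocalization.map_eq _ z⟩
  have hmj : ∀ z, algebraMap _ (FractionRing (Completion A.toSubring)) (completionMap j z) ∈
      quotientSubfield hi ⊔ quotientSubfield hj := fun z =>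
    (le_sup_right : quotientSubfield hj ≤ _) ⟨algebraMap _ _ z, IsLocalization.map_eq _ z⟩
  have htop : quotientSubfield hi ⊔ quotientSubfield hj = ⊤ := by
    refine subfield_eq_top_of_mem (R := R) (D := D) n _ (fun y => ?_) fun d => ?_
    · obtain ⟨z, hz⟩ := hS4 y
      exact hz ▸ hmi z
    · refine mem_subfield_of_sup_eq_top L n
        ((algebraMap _ (FractionRing (Completion A.toSubring))).comp
          (algebraMap A.toSubring (Completion A.toSubring)))
        ((IsFractionRing.injective (Completion A.toSubring) _).comp
          (injective_algebraMap_completion A.toSubring)) M hΩ _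
        (fun a => ?_) (fun a => ?_) _
      · rw [RingHom.comp_apply, ← completionMap_algebraMap (A := S.toSubring) i]
        exact hmi _
      · rw [RingHom.comp_apply, ← completionMap_algebraMap (A := T.toSubring) j]
        exact hmj _
  refine ⟨fun _ => htop, fun _ => ?_⟩
  rw [htop]
  exact .top _ (isLocalRing_integralClosureIn_range _)
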